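/- **Theorem 3.1 (Black-box lower bounds for cloning).** Let $n\ge 0$ and $N=2^n$. Call a random unitary $V$ on $n$ qubits a *state preparation unitary* if $V|0^n\rangle$ is a Haar-random state, i.e. uniformly distributed on the unit sphere of $(\mathbb C^2)^{\otimes n}$; that is, $V$ extends a Haar-random state to an orthonormal basis in an arbitrary, possibly random, way. Such random unitaries exist. Let $(V_i)_{i\in\{0,1\}^n}$ be independent state preparation unitaries, not necessarily with the same law, put $|\psi_i\rangle=V_i|0^n\rangle$, so that the $|\psi_i\rangle$ are $N$ independent Haar-random states, and let $O=\sum_i |i\rangle\langle i|\otimes V_i$ be the corresponding state preparation oracle, which satisfies $O|i\rangle|0^n\rangle=|i\rangle|\psi_i\rangle$. Let $J$ be a uniformly random index in $\{0,1\}^n$, independent of the $V_i$. Let $k,m,T\ge 0$ and consider any $T$-query quantum algorithm that gets $k$ copies of $|\psi_J\rangle$: it computes $$U_{T+1}(O\otimes I)U_T\cdots(O\otimes I)U_1\,|\psi_J\rangle^{\otimes k}|0^m\rangle ,$$ where $U_1,\dots,U_{T+1}$ are arbitrary fixed unitaries on all $kn+m$ qubits, not depending on $J$ or on the oracle, and each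 query acts on some $n$ index qubits and $n$ other qubits; its output $\rho$ is the reduced density matrix of this state on some $(k+1)n$ of the qubits. Then $$\mathbb E\Big[\mathrm F\big(\rho,\;|\psi_J\rangle\langle\psi_J|^{\otimes (k+1)}\big)\Big]\;\le\;2^{-n/4}\,(2T+k+1),$$ where the expectation is over $J$ and the $V_i$ (the fidelity being an integrable function of them), and $\mathrm F(\rho,\sigma)=\big(\mathrm{Tr}\sqrt{\sqrt\rho\,\sigma\sqrt\rho}\,\big)^2$. -/

import Mathlib

namespace BlackBoxCloning

open MeasureTheory

open scoped Matrix

/-- Labels of the computational basis of `n` qubits. -/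
abbrev BitString (n : ℕ) : Type := Fin n → Bool

/-- The all-zeros string. -/
def zeros (n : ℕ) : BitString n := fun _ => false

/-- Unitary operators on `n` qubits, as matrices in the computational basis. -/
abbrev QubitUnitary (n : ℕ) : Type := Matrix.unitaryGroup (BitString n) ℂ

/-- Random unitaries are taken with respect to the Borel σ-algebra. -/
noncomputable instance (n : ℕ) : MeasurableSpace (QubitUnitary n) := borel _

instance (n : ℕ) : BorelSpace (QubitUnitary n) := ⟨rfl⟩

section HaarRandomStates

/-- The law of an `n`-qubit Haar-random state: the uniform probability measure (normalized surface
measure) on the unit sphere of `ℂ^(2^n)`, regarded as a measure on `ℂ^(2^n)`. -/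
noncomputable def haarState (n : ℕ) : Measure (EuclideanSpace ℂ (BitString n)) :=
  let surface : Measure (Metric.sphere (0 : EuclideanSpace ℂ (BitString n)) 1) :=
    (volume : Measure (EuclideanSpace ℂ (BitString n))).toSphere
  Measure.map Subtype.val ((surface Set.univ)⁻¹ • surface)

/-- The state `V |0ⁿ⟩`. -/
noncomputable def preparedState {n : ℕ} (V : QubitUnitary n) : EuclideanSpace ℂ (BitString n) :=
  WithLp.toLp 2 (fun x => V.1 x (zeros n))

/-- `μ` is the law of a random unitary `V` such that `V |0ⁿ⟩` is a Haar-random state. In other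
words, `V` is obtained from a Haar-random state `ψ` by extending `ψ`, in an arbitrary and possibly
random way, to an orthonormal basis. -/
structure IsStatePreparationLaw {n : ℕ} (μ : Measure (QubitUnitary n)) : Prop where
  isProbabilityMeasure : IsProbabilityMeasure μ
  map_preparedState : Measure.map preparedState μ = haarState n

end HaarRandomStates

section Fidelity

open scoped MatrixOrder ComplexOrder

/-- The fidelity `F(ρ, σ) = (Tr √(√ρ σ √ρ))²`. -/
noncomputable def fidelity {B : Type} [Fintype B] [DecidableEq B] (ρ σ : Matrix B B ℂ) : ℝ :=
  (Matrix.trace (CFC.sqrt (CFC.sqrt ρ * σ * CFC.sqrt ρ))).re ^ 2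

end Fidelity

section Registers

variable {Q : Type} [Fintype Q] [DecidableEq Q]

/-- The operator `O ⊗ I` on the qubits `Q`, where `O |i⟩|b⟩ = |i⟩ V_i |b⟩` acts on an `n`-qubit
index register (the wires `w (inl _)`) and an `n`-qubit data register (the wires `w (inr _)`).
Here `φ` lists the amplitudes in the computational basis; `Function.extend (w ∘ inr) b x` is the
bit string obtained from `x` by overwriting the data register with `b`. -/
noncomputable def applyOracle {n : ℕ} (V : BitString n → QubitUnitary n) (w : Fin n ⊕ Fin n ↪ Q)
    (φ : (Q → Bool) → ℂ) : (Q → Bool) → ℂ := fun x =>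
  ∑ b : BitString n,
    (V (fun a => x (w (Sum.inl a)))).1 (fun a => x (w (Sum.inr a))) b *
      φ (Function.extend (fun a => w (Sum.inr a)) b x)

/-- The reduced density matrix of the pure state `φ` on the wires selected by `w`; all other wires
are traced out. -/
noncomputable def reducedState {R : Type} [Fintype R] [DecidableEq R] (w : R ↪ Q)
    (φ : (Q → Bool) → ℂ) : Matrix (R → Bool) (R → Bool) ℂ := fun a b =>
  ∑ x : Q → Bool, if (fun r => x (w r)) = a then φ x * star (φ (Function.extend w b x)) else 0

end Registers

/-- Amplitudes of `|ψ⟩^{⊗ k}` on `k` registers of `n` qubits. -/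
noncomputable def copies {n : ℕ} (k : ℕ) (ψ : EuclideanSpace ℂ (BitString n)) :
    (Fin k × Fin n → Bool) → ℂ := fun x => ∏ j : Fin k, ψ (fun a => x (j, a))

/-- The density matrix `|v⟩⟨v|`. -/
def pureState {B : Type} (v : B → ℂ) : Matrix B B ℂ := Matrix.vecMulVec v (star v)

/-- The qubits of an algorithm: `k` input registers of `n` qubits each, and `m` ancillas. -/
abbrev Wire (n k m : ℕ) : Type := (Fin k × Fin n) ⊕ Fin m

/-- A `T`-query algorithm on `k` input registers and `m` ancilla qubits: `T + 1` fixed unitaries on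
all the qubits, the wires that each query acts on, and the `(k + 1) n` wires that form the
output. -/
structure QueryAlgorithm (n k m T : ℕ) where
  unitary : Fin (T + 1) → Matrix.unitaryGroup (Wire n k m → Bool) ℂ
  queryWires : Fin T → (Fin n ⊕ Fin n ↪ Wire n k m)
  outputWires : Fin (k + 1) × Fin n ↪ Wire n k m

namespace QueryAlgorithm

variable {n k m T : ℕ}

/-- The initial state `|ψ⟩^{⊗ k} |0^m⟩`. -/
noncomputable def initialState (ψ : EuclideanSpace ℂ (BitString n)) : (Wire n k m → Bool) → ℂ :=
  fun x => if ∀ a, x (Sum.inr a) = false then copies k ψ (fun p => x (Sum.inl p)) else 0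

/-- The state after `t` queries, `U_{t+1} (O ⊗ I) U_t ⋯ (O ⊗ I) U_1 |ψ⟩^{⊗ k} |0^m⟩`, where `O` is
the oracle given by `V`. -/
noncomputable def stateAfter (A : QueryAlgorithm n k m T) (V : BitString n → QubitUnitary n)
    (ψ : EuclideanSpace ℂ (BitString n)) (t : Fin (T + 1)) : (Wire n k m → Bool) → ℂ :=
  Fin.induction (motive := fun _ => (Wire n k m → Bool) → ℂ)
    ((A.unitary 0).1 *ᵥ initialState ψ)
    (fun s φ => (A.unitary s.succ).1 *ᵥ applyOracle V (A.queryWires s) φ) t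

/-- The output state `ρ` on `(k + 1) n` qubits. -/
noncomputable def output (A : QueryAlgorithm n k m T) (V : BitString n → QubitUnitary n)
    (ψ : EuclideanSpace ℂ (BitString n)) :
    Matrix (Fin (k + 1) × Fin n → Bool) (Fin (k + 1) × Fin n → Bool) ℂ :=
  reducedState A.outputWires (A.stateAfter V ψ (Fin.last T))

/-- The fidelity between the output of the algorithm, run with the oracle `V` on `k` copies of
`ψ_J = V_J |0ⁿ⟩`, and `|ψ_J⟩⟨ψ_J|^{⊗ (k + 1)}`. -/
noncomputable def cloningFidelity (A : QueryAlgorithm n k m T) (V : BitString n → QubitUnitary n)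
    (J : BitString n) : ℝ :=
  fidelity (A.output V (preparedState (V J))) (pureState (copies (k + 1) (preparedState (V J))))

end QueryAlgorithm

end BlackBoxCloning

/-! Write N = 2^n. The oracle helps to clone only through its entry at J, and an algorithm that does
not know J can put little query weight there on average.

Resampling: replacing V_J by an independent W with the same law leaves the joint law of the oracle
unchanged (`measurePreserving_update`). The algorithm may thus be taken to clone ψ = W|0^n⟩, which
is Haar-random and independent of V, while it queries V with W substituted at J.

Hybrid argument: undoing that substitution moves the final state by at most twice the total
amplitude with which the run on V queries J (`l2norm_stateAfter_update_sub_le`), so the fidelity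
changes by at most four times that amplitude. The run on V does not involve J. By Cauchy–Schwarz
over the N indices, the weights sum over J to at most T√N (`sum_queryWeight_le`), an average of
T/√N.

No useful oracle: for V fixed independently of ψ, the algorithm is a linear isometry applied to k
copies of ψ. Its expected fidelity is at most dim Sym^k / dim Sym^(k+1) = (k+1)/(N+k)
(`integral_cloning_le`). This combines Cauchy–Schwarz in the symmetric subspace, which removes the
input copies, with the moments of degree k+1 of a Haar state
(`integral_normSq_contract_haarState_le`), obtained from complex Gaussian moments by polar
coordinates.

In total the average fidelity is at most (k+1)/(N+k) + 4T/√N. Together with the trivial bound 1 this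
gives the stated estimate (`le_cloning_bound`). -/

namespace BlackBoxCloning

open MeasureTheory

open scoped Matrix

/-! ### Moments of complex Gaussian vectors. -/

section GaussianMoments

open scoped ComplexConjugate Nat

lemma integrable_norm_pow_mul_gaussian (p : ℕ) :
    Integrable (fun z : ℂ => ‖z‖ ^ p * Real.exp (-‖z‖ ^ 2)) := by
  have h := Complex.integral_rpow_mul_exp_neg_rpow (p := 2) (q := p) (by norm_num)
    (by linarith [(Nat.cast_nonneg p : (0 : ℝ) ≤ p)])
  simp only [Real.rpow_natCast, Real.rpow_ofNat] at h
  -- A non-integrable function has Bochner integral 0, whereas the closed form is positive.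
  by_contra hc
  rw [integral_undef hc] at h
  have : 0 < Real.Gamma (((p : ℝ) + 2) / 2) := Real.Gamma_pos_of_pos (by positivity)
  have : 0 < 2 * Real.pi / 2 * Real.Gamma (((p : ℝ) + 2) / 2) := by positivity
  exact absurd h this.ne

lemma integrable_conj_pow_mul_pow_mul_gaussian (p q : ℕ) :
    Integrable (fun z : ℂ => conj z ^ p * z ^ q * (Real.exp (-‖z‖ ^ 2) : ℂ)) := by
  refine (integrable_norm_pow_mul_gaussian (p + q)).mono'
    (by fun_prop) (.of_forall fun z => ?_)
  simp only [norm_mul, norm_pow, RCLike.norm_conj, Complex.norm_real, Real.norm_eq_abs,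
    Real.abs_exp, pow_add]
  exact le_rfl

lemma integral_conj_pow_mul_pow_mul_gaussian (p q : ℕ) :
    ∫ z : ℂ, conj z ^ p * z ^ q * (Real.exp (-‖z‖ ^ 2) : ℂ) =
      if p = q then (Real.pi : ℂ) * p ! else 0 := by
  split_ifs with hpq
  · subst hpq
    have h := Complex.integral_rpow_mul_exp_neg_rpow (p := 2) (q := (2 * p : ℕ)) (by norm_num)
      (by linarith [(Nat.cast_nonneg (2 * p) : (0 : ℝ) ≤ (2 * p : ℕ))])
    simp only [Real.rpow_natCast, Real.rpow_ofNat] at h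
    have h2 : (((2 * p : ℕ) : ℝ) + 2) / 2 = p + 1 := by push_cast; ring
    rw [h2, Real.Gamma_nat_eq_factorial] at h
    calc _ = ∫ z : ℂ, ((‖z‖ ^ (2 * p) * Real.exp (-‖z‖ ^ 2) : ℝ) : ℂ) := by
          refine integral_congr_ae (.of_forall fun z => ?_)
          simp only [← mul_pow, Complex.conj_mul']
          push_cast
          ring
      _ = _ := by
          rw [integral_complex_ofReal, h]
          push_cast
          ring
  · set I := ∫ z : ℂ, conj z ^ p * z ^ q * (Real.exp (-‖z‖ ^ 2) : ℂ) with hI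
    have hd : ((q : ℝ) - p) ≠ 0 := sub_ne_zero.2 fun h => hpq (by exact_mod_cast h.symm)
    -- Rotating by θ multiplies the integrand by exp(i(q - p)θ) = -1 and preserves the measure, so I
    -- = -I.
    set θ : ℝ := Real.pi / (q - p)
    set ζ : Circle := Circle.exp θ
    have hζ : conj (ζ : ℂ) ^ p * (ζ : ℂ) ^ q = -1 := by
      rw [Circle.coe_exp, ← Complex.exp_conj, ← Complex.exp_nat_mul, ← Complex.exp_nat_mul,
        ← Complex.exp_add, ← Complex.exp_pi_mul_I]
      congr 1
      have : (q - p : ℂ) ≠ 0 := by exact_mod_cast hd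
      simp only [map_mul, Complex.conj_ofReal, Complex.conj_I, θ]
      push_cast
      field_simp
      ring
    have h := (LinearIsometryEquiv.measurePreserving (rotation ζ)).integral_comp
      (rotation ζ).toHomeomorph.measurableEmbedding
      (fun z : ℂ => conj z ^ p * z ^ q * (Real.exp (-‖z‖ ^ 2) : ℂ))
    rw [← hI] at h
    have h2 : ∫ z : ℂ, conj (rotation ζ z) ^ p * (rotation ζ z) ^ q *
        (Real.exp (-‖rotation ζ z‖ ^ 2) : ℂ) = -I := by
      rw [hI, ← integral_neg]
      refine integral_congr_ae (.of_forall fun z => ?_)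
      simp only [LinearIsometryEquiv.norm_map]
      simp only [rotation_apply, map_mul, mul_pow]
      linear_combination (conj z ^ p * z ^ q * (Real.exp (-‖z‖ ^ 2) : ℂ)) * hζ
    rw [h2] at h
    exact self_eq_neg.1 h.symm

/-- If the fibres of a and b have equal sizes, some τ satisfies a ∘ τ = b, and right multiplication
by τ maps the stabilizer of a, of order the product of the factorials, onto the solutions. Otherwise
there are no solutions. This turns products of one-variable moments into Wick's formula. -/
lemma card_perm_comp_eq {α ι : Type*} [Fintype α] [Fintype ι] [DecidableEq α] [DecidableEq ι]
    (a b : ι → α) :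
    (∏ i, if Fintype.card {j // a j = i} = Fintype.card {j // b j = i} then
      (Fintype.card {j // a j = i})! else 0) =
      Fintype.card {σ : Equiv.Perm ι // a ∘ σ = b} := by
  by_cases h : ∀ i, Fintype.card {j // a j = i} = Fintype.card {j // b j = i}
  · have e : ∀ i, {j // b j = i} ≃ {j // a j = i} := fun i => (Fintype.equivOfCardEq (h i)).symm
    have hτ : a ∘ (Equiv.ofFiberEquiv e) = b := funext fun j => Equiv.ofFiberEquiv_map e j
    set τ := Equiv.ofFiberEquiv e
    simp only [h, if_true]
    simp only [← h]
    rw [← DomMulAct.stabilizer_card]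
    refine Fintype.card_congr ((Equiv.mulRight τ).subtypeEquiv fun σ => ?_)
    rw [Equiv.coe_mulRight, Equiv.Perm.coe_mul, ← Function.comp_assoc]
    conv_rhs => rw [← hτ]
    exact ⟨fun h => by rw [h], fun h => τ.surjective.injective_comp_right h⟩
  · have h' := h
    push Not at h'
    obtain ⟨i, hi⟩ := h'
    rw [Finset.prod_eq_zero (Finset.mem_univ i) (if_neg hi), eq_comm, Fintype.card_eq_zero_iff]
    refine ⟨fun ⟨σ, hσ⟩ => hi ?_⟩
    refine (Fintype.card_congr (σ.subtypeEquiv fun j => ?_)).symm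
    rw [← hσ, Function.comp_apply]

variable {α : Type*} [Fintype α] {K : ℕ}

/-- The tensor `f` contracted with `x ⊗ ⋯ ⊗ x`, conjugated. -/
noncomputable def contract (f : (Fin K → α) → ℂ) (x : α → ℂ) : ℂ :=
  ∑ a, (∏ j, conj (x (a j))) * f a

lemma normSq_contract_mul_gaussian (f : (Fin K → α) → ℂ) (x : α → ℂ) :
    ((‖contract f x‖ ^ 2 * Real.exp (-∑ i, ‖x i‖ ^ 2) : ℝ) : ℂ) =
      ∑ a, ∑ b, f a * conj (f b) * ((∏ j, conj (x (a j))) * (∏ j, x (b j)) *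
        (Real.exp (-∑ i, ‖x i‖ ^ 2) : ℂ)) := by
  push_cast
  rw [← Complex.mul_conj', contract, map_sum, Finset.sum_mul_sum, Finset.sum_mul]
  refine Finset.sum_congr rfl fun a _ => ?_
  rw [Finset.sum_mul]
  refine Finset.sum_congr rfl fun b _ => ?_
  simp only [map_mul, map_prod, Complex.conj_conj]
  ring

variable [DecidableEq α]

lemma prod_comp_eq_prod_pow_card (a : Fin K → α) (x : α → ℂ) :
    ∏ j, x (a j) = ∏ i, x i ^ Fintype.card {j // a j = i} := by
  rw [← Finset.prod_fiberwise' (s := Finset.univ) (g := a) (f := x)]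
  refine Finset.prod_congr rfl fun i _ => ?_
  rw [Finset.prod_const, Fintype.card_subtype]

lemma monomial_mul_gaussian_eq_prod (a b : Fin K → α) (x : α → ℂ) :
    (∏ j, conj (x (a j))) * (∏ j, x (b j)) * (Real.exp (-∑ i, ‖x i‖ ^ 2) : ℂ) =
      ∏ i, (conj (x i) ^ Fintype.card {j // a j = i} * x i ^ Fintype.card {j // b j = i} *
        (Real.exp (-‖x i‖ ^ 2) : ℂ)) := by
  rw [prod_comp_eq_prod_pow_card b x, prod_comp_eq_prod_pow_card a (fun i => conj (x i)),
    Finset.prod_mul_distrib, Finset.prod_mul_distrib, ← Finset.sum_neg_distrib, Real.exp_sum]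
  push_cast
  rfl

lemma integrable_monomial_mul_gaussian (a b : Fin K → α) :
    Integrable (fun x : α → ℂ => (∏ j, conj (x (a j))) * (∏ j, x (b j)) *
      (Real.exp (-∑ i, ‖x i‖ ^ 2) : ℂ)) := by
  simp only [monomial_mul_gaussian_eq_prod]
  exact Integrable.fintype_prod (f := fun i (z : ℂ) => conj z ^ Fintype.card {j // a j = i} *
    z ^ Fintype.card {j // b j = i} * (Real.exp (-‖z‖ ^ 2) : ℂ))
    fun i => integrable_conj_pow_mul_pow_mul_gaussian _ _

lemma integral_monomial_mul_gaussian (a b : Fin K → α) :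
    ∫ x : α → ℂ, (∏ j, conj (x (a j))) * (∏ j, x (b j)) * (Real.exp (-∑ i, ‖x i‖ ^ 2) : ℂ) =
      (Real.pi : ℂ) ^ Fintype.card α * Fintype.card {σ : Equiv.Perm (Fin K) // a ∘ σ = b} := by
  simp only [monomial_mul_gaussian_eq_prod]
  rw [integral_fintype_prod_volume_eq_prod (fun i (z : ℂ) =>
    conj z ^ Fintype.card {j // a j = i} * z ^ Fintype.card {j // b j = i} *
      (Real.exp (-‖z‖ ^ 2) : ℂ)), ← card_perm_comp_eq, ← Finset.card_univ, ← Finset.prod_const,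
    Nat.cast_prod, ← Finset.prod_mul_distrib]
  refine Finset.prod_congr rfl fun i _ => ?_
  rw [integral_conj_pow_mul_pow_mul_gaussian]
  split_ifs <;> simp

/-- By Wick's formula the integral is π^N times the sum over permutations σ of the inner products of
f with f ∘ σ. Permuting the tensor legs preserves the norm, so each of the K! terms is at most ‖f‖².
-/
lemma integral_normSq_contract_mul_gaussian_le (f : (Fin K → α) → ℂ) :
    ∫ x : α → ℂ, ‖contract f x‖ ^ 2 * Real.exp (-∑ i, ‖x i‖ ^ 2) ≤
      Real.pi ^ Fintype.card α * K ! * ∑ a, ‖f a‖ ^ 2 := by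
  have key : ((∫ x : α → ℂ, ‖contract f x‖ ^ 2 * Real.exp (-∑ i, ‖x i‖ ^ 2) : ℝ) : ℂ) =
      (Real.pi : ℂ) ^ Fintype.card α *
        ∑ σ : Equiv.Perm (Fin K), ∑ a, f a * conj (f (a ∘ σ)) := by
    rw [← integral_complex_ofReal]
    simp only [normSq_contract_mul_gaussian]
    rw [integral_finsetSum _ fun a _ => integrable_finsetSum _ fun b _ =>
      (integrable_monomial_mul_gaussian a b).const_mul _, Finset.sum_comm, Finset.mul_sum]
    refine Finset.sum_congr rfl fun a _ => ?_
    rw [integral_finsetSum _ fun b _ => (integrable_monomial_mul_gaussian a b).const_mul _]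
    simp only [integral_const_mul, integral_monomial_mul_gaussian]
    have : ∀ b, (Fintype.card {σ : Equiv.Perm (Fin K) // a ∘ σ = b} : ℂ) =
        ∑ σ : Equiv.Perm (Fin K), if a ∘ σ = b then 1 else 0 := fun b => by
      rw [Fintype.card_subtype, Finset.sum_boole]
    simp only [this, Finset.mul_sum]
    rw [Finset.sum_comm]
    refine Finset.sum_congr rfl fun σ _ => ?_
    simp only [mul_ite, mul_one, mul_zero, Finset.sum_ite_eq, Finset.mem_univ, if_true]
    ring
  have hnn : 0 ≤ ∫ x : α → ℂ, ‖contract f x‖ ^ 2 * Real.exp (-∑ i, ‖x i‖ ^ 2) :=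
    integral_nonneg fun x => by positivity
  rw [← Real.norm_of_nonneg hnn, ← Complex.norm_real, key, norm_mul, norm_pow,
    Complex.norm_real, Real.norm_of_nonneg Real.pi_pos.le, mul_assoc]
  refine mul_le_mul_of_nonneg_left ?_ (by positivity)
  have hσ : ∀ σ : Equiv.Perm (Fin K), ‖∑ a, f a * conj (f (a ∘ σ))‖ ≤ ∑ a, ‖f a‖ ^ 2 := by
    intro σ
    have hre : ∑ a : Fin K → α, ‖f (a ∘ σ)‖ ^ 2 = ∑ a, ‖f a‖ ^ 2 :=
      Equiv.sum_comp (σ.symm.arrowCongr (Equiv.refl α)) (fun a => ‖f a‖ ^ 2)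
    calc _ ≤ ∑ a, ‖f a * conj (f (a ∘ σ))‖ := norm_sum_le _ _
      _ ≤ ∑ a, (‖f a‖ ^ 2 + ‖f (a ∘ σ)‖ ^ 2) / 2 := Finset.sum_le_sum fun a _ => by
          rw [norm_mul, RCLike.norm_conj]
          nlinarith [sq_nonneg (‖f a‖ - ‖f (a ∘ σ)‖)]
      _ = _ := by rw [← Finset.sum_div, Finset.sum_add_distrib, hre]; ring
  calc _ ≤ ∑ σ : Equiv.Perm (Fin K), ∑ a, ‖f a‖ ^ 2 :=
        (norm_sum_le _ _).trans (Finset.sum_le_sum fun σ _ => hσ σ)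
    _ = _ := by simp [Finset.card_univ, Fintype.card_perm]

lemma integral_gaussian_pi :
    ∫ x : α → ℂ, Real.exp (-∑ i, ‖x i‖ ^ 2) = Real.pi ^ Fintype.card α := by
  -- The empty monomial: the only permutation of no legs contributes 1.
  have h := integral_monomial_mul_gaussian (K := 0) (α := α) Fin.elim0 Fin.elim0
  simp only [Finset.univ_eq_empty, Finset.prod_empty, one_mul] at h
  rw [integral_complex_ofReal] at h
  have hc : Fintype.card {σ : Equiv.Perm (Fin 0) // (Fin.elim0 : Fin 0 → α) ∘ σ = Fin.elim0} = 1 :=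
    Fintype.card_eq_one_iff.2 ⟨⟨1, funext fun i => i.elim0⟩, fun _ => Subsingleton.elim _ _⟩
  rw [hc, Nat.cast_one, mul_one] at h
  exact_mod_cast h

end GaussianMoments

/-! ### From Gaussian moments to moments of Haar-random states. -/

section SphereMoments

open scoped ComplexConjugate Nat

/-- Integration in polar coordinates of a homogeneous function against a Gaussian weight. -/
lemma integral_homogeneous_mul_gaussian {E : Type*} [NormedAddCommGroup E] [NormedSpace ℝ E]
    [MeasurableSpace E] [BorelSpace E] [FiniteDimensional ℝ E] [Nontrivial E] (μ : Measure E)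
    [μ.IsAddHaarMeasure] (f : E → ℝ) (p : ℕ)
    (hf : ∀ (r : ℝ) (x : E), 0 < r → f (r • x) = r ^ p * f x) :
    ∫ x, f x * Real.exp (-‖x‖ ^ 2) ∂μ =
      (∫ x : Metric.sphere (0 : E) 1, f x ∂μ.toSphere) *
        (Real.Gamma (((Module.finrank ℝ E + p : ℕ) : ℝ) / 2) / 2) := by
  -- The radial density is r^(d - 1) with truncated subtraction; positivity of d makes the exponents
  -- add up to d + p below.
  have hd : 0 < Module.finrank ℝ E := Module.finrank_pos
  calc ∫ x, f x * Real.exp (-‖x‖ ^ 2) ∂μ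
      = ∫ x : ({(0)}ᶜ : Set E), f x * Real.exp (-‖(x : E)‖ ^ 2) ∂(μ.comap (↑)) := by
        rw [integral_subtype_comap (measurableSet_singleton _).compl
          fun x ↦ f x * Real.exp (-‖x‖ ^ 2), restrict_compl_singleton]
    _ = ∫ y : Metric.sphere (0 : E) 1 × Set.Ioi (0 : ℝ),
          f y.1 * ((y.2 : ℝ) ^ p * Real.exp (-(y.2 : ℝ) ^ 2))
            ∂μ.toSphere.prod (.volumeIoiPow (Module.finrank ℝ E - 1)) := by
        rw [← μ.measurePreserving_homeomorphUnitSphereProd.integral_comp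
          (Homeomorph.measurableEmbedding _)]
        refine integral_congr_ae (.of_forall fun x => ?_)
        have hx : (0 : ℝ) < ‖(x : E)‖ := norm_pos_iff.2 x.2
        have := hf ‖(x : E)‖ (‖(x : E)‖⁻¹ • x) hx
        rw [smul_smul, mul_inv_cancel₀ hx.ne', one_smul] at this
        simp only [homeomorphUnitSphereProd_apply_fst_coe, homeomorphUnitSphereProd_apply_snd_coe]
        rw [this]
        ring
    _ = (∫ x : Metric.sphere (0 : E) 1, f x ∂μ.toSphere) *
          ∫ r : Set.Ioi (0 : ℝ), (r : ℝ) ^ p * Real.exp (-(r : ℝ) ^ 2)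
            ∂.volumeIoiPow (Module.finrank ℝ E - 1) :=
        integral_prod_mul (fun x : Metric.sphere (0 : E) 1 => f x)
          (fun r : Set.Ioi (0 : ℝ) => (r : ℝ) ^ p * Real.exp (-(r : ℝ) ^ 2))
    _ = _ := by
        congr 1
        simp only [Measure.volumeIoiPow, ENNReal.ofReal]
        rw [integral_withDensity_eq_integral_smul
          (measurable_subtype_coe.pow_const _).real_toNNReal,
          integral_subtype_comap measurableSet_Ioi fun r ↦
            Real.toNNReal (r ^ (Module.finrank ℝ E - 1)) • (r ^ p * Real.exp (-r ^ 2))]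
        have h := integral_rpow_mul_exp_neg_rpow (p := 2)
          (q := (Module.finrank ℝ E - 1 + p : ℕ)) two_pos
          (by linarith [(Nat.cast_nonneg (Module.finrank ℝ E - 1 + p) :
            (0 : ℝ) ≤ (Module.finrank ℝ E - 1 + p : ℕ))])
        simp only [Real.rpow_natCast, Real.rpow_ofNat] at h
        have h2 : ((Module.finrank ℝ E - 1 + p : ℕ) : ℝ) + 1 = (Module.finrank ℝ E + p : ℕ) := by
          exact_mod_cast (by omega : Module.finrank ℝ E - 1 + p + 1 = Module.finrank ℝ E + p)
        rw [h2] at h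
        rw [div_eq_mul_one_div (Real.Gamma _), mul_comm (Real.Gamma _), ← h]
        refine setIntegral_congr_fun measurableSet_Ioi fun r hr ↦ ?_
        simp only [NNReal.smul_def, Real.coe_toNNReal _ (pow_nonneg (le_of_lt hr) _), pow_add,
          smul_eq_mul]
        ring

variable {n : ℕ}

instance : Nontrivial (EuclideanSpace ℂ (BitString n)) :=
  inferInstanceAs (Nontrivial (PiLp 2 fun _ : BitString n => ℂ))

instance isProbabilityMeasure_haarState (n : ℕ) : IsProbabilityMeasure (haarState n) := by
  refine ⟨?_⟩
  rw [haarState, Measure.map_apply measurable_subtype_coe .univ, Set.preimage_univ,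
    Measure.smul_apply, smul_eq_mul]
  refine ENNReal.inv_mul_cancel ?_ (measure_ne_top _ _)
  rw [Measure.measure_univ_ne_zero]
  exact Measure.toSphere_ne_zero _

lemma integral_haarState (f : EuclideanSpace ℂ (BitString n) → ℝ) :
    ∫ x, f x ∂haarState n =
      ((volume : Measure (EuclideanSpace ℂ (BitString n))).toSphere.real Set.univ)⁻¹ *
        ∫ x : Metric.sphere (0 : EuclideanSpace ℂ (BitString n)) 1, f x
          ∂(volume : Measure (EuclideanSpace ℂ (BitString n))).toSphere := by
  rw [haarState, (MeasurableEmbedding.subtype_coe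
    (Metric.isClosed_sphere.measurableSet)).integral_map, integral_smul_measure,
    ENNReal.toReal_inv]
  rfl

lemma ae_norm_eq_one_haarState : ∀ᵐ x ∂haarState n, ‖x‖ = 1 := by
  rw [haarState, (MeasurableEmbedding.subtype_coe
    (Metric.isClosed_sphere.measurableSet)).ae_map_iff]
  exact .of_forall fun x => by simp

lemma integrable_haarState_of_continuous {f : EuclideanSpace ℂ (BitString n) → ℝ}
    (hf : Continuous f) : Integrable f (haarState n) := by
  obtain ⟨C, hC⟩ := (isCompact_sphere (0 : EuclideanSpace ℂ (BitString n)) 1).exists_bound_of_continuousOn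
    hf.continuousOn
  refine Integrable.of_bound hf.aestronglyMeasurable C ?_
  filter_upwards [ae_norm_eq_one_haarState] with x hx
  exact hC x (by simpa using hx)

/-- Both volumes are Haar measures, hence proportional. The value of c is irrelevant, as it cancels
between the moment and the total mass of the sphere. -/
lemma integral_euclidean_gaussian : ∃ c : ℝ, 0 < c ∧ ∀ f : EuclideanSpace ℂ (BitString n) → ℝ,
    ∫ x, f x = c * ∫ x : BitString n → ℂ, f (WithLp.toLp 2 x) := by
  set e := (PiLp.continuousLinearEquiv 2 ℝ fun _ : BitString n => ℂ).symm
  set ν : Measure (EuclideanSpace ℂ (BitString n)) :=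
    Measure.map e (volume : Measure (BitString n → ℂ))
  have : ν.IsAddHaarMeasure := e.isAddHaarMeasure_map volume
  refine ⟨(volume : Measure (EuclideanSpace ℂ (BitString n))).addHaarScalarFactor ν, ?_,
    fun f => ?_⟩
  · exact Measure.addHaarScalarFactor_pos_of_isAddHaarMeasure _ _
  · conv_lhs => rw [Measure.isAddLeftInvariant_eq_smul
      (volume : Measure (EuclideanSpace ℂ (BitString n))) ν]
    rw [integral_smul_nnreal_measure, NNReal.smul_def, smul_eq_mul]
    congr 1
    exact e.toHomeomorph.measurableEmbedding.integral_map f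

lemma norm_sq_toLp (x : BitString n → ℂ) : ‖WithLp.toLp 2 x‖ ^ 2 = ∑ i, ‖x i‖ ^ 2 :=
  EuclideanSpace.norm_sq_eq _

lemma contract_smul {K : ℕ} (f : (Fin K → BitString n) → ℂ) (r : ℝ)
    (x : EuclideanSpace ℂ (BitString n)) : contract f (WithLp.ofLp (r • x)) = (r : ℂ) ^ K * contract f x := by
  simp only [contract, Finset.mul_sum]
  refine Finset.sum_congr rfl fun a _ => ?_
  simp [Finset.prod_mul_distrib]
  ring

lemma continuous_contract {K : ℕ} (f : (Fin K → BitString n) → ℂ) :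
    Continuous fun x : EuclideanSpace ℂ (BitString n) => contract f x := by
  unfold contract
  fun_prop

/-- The moments of a Haar-random state. -/
lemma integral_normSq_contract_haarState_le {K : ℕ} (f : (Fin K → BitString n) → ℂ) :
    ∫ x, ‖contract f x‖ ^ 2 ∂haarState n ≤
      (∑ a, ‖f a‖ ^ 2) / Nat.multichoose (2 ^ n) K := by
  obtain ⟨c, hc, hvol⟩ := integral_euclidean_gaussian (n := n)
  set N := 2 ^ n with hN
  have hN0 : 0 < N := by positivity
  have hcard : Fintype.card (BitString n) = N := by simp [hN]
  have hdim : Module.finrank ℝ (EuclideanSpace ℂ (BitString n)) = 2 * N := by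
    rw [finrank_real_of_complex, finrank_euclideanSpace, hcard]
  set σ := (volume : Measure (EuclideanSpace ℂ (BitString n))).toSphere
  -- Polar coordinates are used twice: degree 0 gives the total mass of the sphere, degree 2K the
  -- moment. In real dimension 2N the radial factors are Γ(N)/2 and Γ(N + K)/2, and their ratio with
  -- K! yields the multiset coefficient.
  have h1 := integral_homogeneous_mul_gaussian
    (volume : Measure (EuclideanSpace ℂ (BitString n))) (fun _ => 1) 0 (by simp)
  have h2 := integral_homogeneous_mul_gaussian
    (volume : Measure (EuclideanSpace ℂ (BitString n))) (fun x => ‖contract f x‖ ^ 2) (2 * K)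
    (fun r x hr => by
      simp only [contract_smul, norm_mul, norm_pow, Complex.norm_real, Real.norm_of_nonneg hr.le]
      ring)
  have e1 : (((2 * N + 0 : ℕ) : ℝ) / 2) = ((N - 1 : ℕ) : ℝ) + 1 := by
    push_cast [Nat.cast_pred hN0]; ring
  have e2 : (((2 * N + 2 * K : ℕ) : ℝ) / 2) = ((N + K - 1 : ℕ) : ℝ) + 1 := by
    rw [Nat.cast_pred (by omega)]; push_cast; ring
  rw [hdim, e1, Real.Gamma_nat_eq_factorial, hvol] at h1
  rw [hdim, e2, Real.Gamma_nat_eq_factorial, hvol] at h2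
  simp only [norm_sq_toLp, one_mul, integral_gaussian_pi, integral_const, smul_eq_mul, mul_one,
    hcard] at h1 h2
  have h3 := integral_normSq_contract_mul_gaussian_le f
  rw [hcard] at h3
  have h4 : c * ∫ x : BitString n → ℂ, ‖contract f x‖ ^ 2 * Real.exp (-∑ i, ‖x i‖ ^ 2) ≤
      c * (Real.pi ^ N * K ! * ∑ a, ‖f a‖ ^ 2) := mul_le_mul_of_nonneg_left h3 hc.le
  change c * ∫ x : BitString n → ℂ, ‖contract f x‖ ^ 2 * Real.exp (-∑ i, ‖x i‖ ^ 2) = _ at h2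
  rw [h2] at h4
  rw [integral_haarState]
  have hchoose : (Nat.multichoose N K : ℝ) * (K ! * (N - 1)!) = (N + K - 1)! := by
    rw [Nat.multichoose_eq]
    have := Nat.choose_mul_factorial_mul_factorial (show K ≤ N + K - 1 by omega)
    rw [show N + K - 1 - K = N - 1 by omega] at this
    rw [← mul_assoc]
    exact_mod_cast this
  have hM : (0 : ℝ) < Nat.multichoose N K := by
    rw [Nat.multichoose_eq]
    exact_mod_cast Nat.choose_pos (by omega)
  have hσ : 0 < σ.real Set.univ := by
    rw [measureReal_def]
    refine ENNReal.toReal_pos ?_ (measure_ne_top _ _)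
    rw [Measure.measure_univ_ne_zero]
    exact Measure.toSphere_ne_zero _
  rw [inv_mul_le_iff₀ hσ, mul_div_assoc', le_div_iff₀ hM]
  have hf1 : (0 : ℝ) < K ! := by exact_mod_cast Nat.factorial_pos K
  have hf2 : (0 : ℝ) < (N - 1)! := by exact_mod_cast Nat.factorial_pos _
  refine le_of_mul_le_mul_right ?_ (mul_pos hf1 (half_pos hf2))
  calc _ = (∫ x : Metric.sphere (0 : EuclideanSpace ℂ (BitString n)) 1, ‖contract f x‖ ^ 2 ∂σ) *
        (((Nat.multichoose N K : ℝ) * (K ! * (N - 1)!)) / 2) := by ring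
    _ ≤ c * (Real.pi ^ N * K ! * ∑ a, ‖f a‖ ^ 2) := by rw [hchoose]; exact h4
    _ = (c * Real.pi ^ N) * (K ! * ∑ a, ‖f a‖ ^ 2) := by ring
    _ = _ := by rw [h1]; ring

end SphereMoments

/-! ### Optimal cloning by a fixed contraction, via the symmetric subspace. -/

section CloningWithoutOracle

variable {α : Type*} {k : ℕ}

/-- The multiset of values of a tuple. -/
def symOfFn (a : Fin k → α) : Sym α k := ⟨Finset.univ.val.map a, by simp⟩

lemma symOfFn_surjective : Function.Surjective (symOfFn (α := α) (k := k)) := by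
  intro s
  obtain ⟨l, hl⟩ := Quotient.exists_rep s.1
  have hk : l.length = k := by
    have := s.2
    rw [← hl] at this
    simpa using this
  subst hk
  refine ⟨l.get, Subtype.ext ?_⟩
  rw [← hl]
  change Multiset.map l.get Finset.univ.val = (l : Multiset α)
  rw [Fin.univ_val_map, List.ofFn_get]

lemma prod_comp_eq_prod_map_symOfFn (x : α → ℂ) (a : Fin k → α) :
    ∏ j, x (a j) = ((symOfFn a : Multiset α).map x).prod := by
  simp only [symOfFn, Sym.coe_mk, Multiset.map_map, Finset.prod_map_val]
  rfl

lemma sum_normSq_prod_comp [Fintype α] (x : α → ℂ) :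
    ∑ a : Fin k → α, ‖∏ j, x (a j)‖ ^ 2 = (∑ i, ‖x i‖ ^ 2) ^ k := by
  rw [← Fin.prod_const, Finset.prod_univ_sum]
  simp [norm_prod, Finset.prod_pow]

variable [Fintype α] [DecidableEq α]

lemma card_symOfFn_eq_pos (s : Sym α k) :
    (0 : ℝ) < Fintype.card {a : Fin k → α // symOfFn a = s} := by
  obtain ⟨a, ha⟩ := symOfFn_surjective s
  have : Nonempty {a : Fin k → α // symOfFn a = s} := ⟨⟨a, ha⟩⟩
  exact_mod_cast Fintype.card_pos

/-- A tensor power is constant on tuples with the same multiset of values. The indicators of these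
classes form an orthogonal basis of the symmetric subspace, with squared norms the class sizes. -/
lemma tensorPower_eq_sum_sym (x : α → ℂ) :
    (fun a : Fin k → α => ∏ j, x (a j)) =
      ∑ s : Sym α k, ((s : Multiset α).map x).prod •
        (fun a : Fin k → α => if symOfFn a = s then (1 : ℂ) else 0) := by
  funext a
  simp [Finset.sum_apply, prod_comp_eq_prod_map_symOfFn]

/-- Cauchy–Schwarz in the symmetric subspace. -/
lemma normSq_map_tensorPower_le (x : α → ℂ) (hx : ∑ i, ‖x i‖ ^ 2 = 1)
    (L : ((Fin k → α) → ℂ) →ₗ[ℂ] ℂ) :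
    ‖L (fun a => ∏ j, x (a j))‖ ^ 2 ≤
      ∑ s : Sym α k, ‖L (fun a => if symOfFn a = s then (1 : ℂ) else 0)‖ ^ 2 /
        Fintype.card {a : Fin k → α // symOfFn a = s} := by
  have hm : ∀ s : Sym α k, (0 : ℝ) < Fintype.card {a : Fin k → α // symOfFn a = s} := card_symOfFn_eq_pos
  set m : Sym α k → ℝ := fun s => Fintype.card {a : Fin k → α // symOfFn a = s} with hmdef
  -- The unit norm of the tensor power, written in this orthogonal basis. The weights m make the
  -- Cauchy–Schwarz bound independent of x.
  have h1 : ∑ s : Sym α k, m s * ‖((s : Multiset α).map x).prod‖ ^ 2 = 1 := by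
    have h := sum_normSq_prod_comp (k := k) x
    rw [hx, one_pow] at h
    rw [← h, ← Finset.sum_fiberwise (s := Finset.univ) (g := symOfFn)]
    refine Finset.sum_congr rfl fun s _ => ?_
    rw [Finset.sum_congr rfl (g := fun _ => ‖((s : Multiset α).map x).prod‖ ^ 2) fun a ha => by
      rw [prod_comp_eq_prod_map_symOfFn, (Finset.mem_filter.1 ha).2]]
    rw [Finset.sum_const, nsmul_eq_mul, hmdef]
    simp only [Fintype.card_subtype]
  rw [tensorPower_eq_sum_sym, map_sum]
  simp only [map_smul, smul_eq_mul]
  calc _ ≤ (∑ s : Sym α k, ‖((s : Multiset α).map x).prod‖ *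
        ‖L (fun a => if symOfFn a = s then (1 : ℂ) else 0)‖) ^ 2 := by
        refine pow_le_pow_left₀ (norm_nonneg _) ((norm_sum_le _ _).trans_eq ?_) 2
        simp only [norm_mul]
    _ ≤ (∑ s : Sym α k, m s * ‖((s : Multiset α).map x).prod‖ ^ 2) *
        ∑ s : Sym α k, ‖L (fun a => if symOfFn a = s then (1 : ℂ) else 0)‖ ^ 2 / m s := by
        refine Finset.sum_sq_le_sum_mul_sum_of_sq_le_mul _
          (fun s _ => mul_nonneg (hm s).le (sq_nonneg _))
          (fun s _ => div_nonneg (sq_nonneg _) (hm s).le) fun s _ => ?_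
        have := (hm s).ne'
        rw [mul_pow, mul_right_comm, mul_div_cancel₀ _ this, mul_comm]
    _ = _ := by rw [h1, one_mul]

/-- The ratio of the dimensions of consecutive symmetric powers of an N-dimensional space. -/
lemma multichoose_div_multichoose (N k : ℕ) (hN : 0 < N) :
    (Nat.multichoose N k : ℝ) / Nat.multichoose N (k + 1) = (k + 1) / (N + k) := by
  have h := Nat.add_one_mul_choose_eq (N + k - 1) k
  have e1 : N + k - 1 + 1 = N + k := by omega
  rw [Nat.multichoose_eq, Nat.multichoose_eq, show N + (k + 1) - 1 = N + k by omega]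
  rw [e1] at h
  have hpos : (0 : ℝ) < (N + k).choose (k + 1) := by exact_mod_cast Nat.choose_pos (by omega)
  have hN' : (0 : ℝ) < N + k := by
    have : (0 : ℝ) < N := by exact_mod_cast hN
    positivity
  rw [div_eq_div_iff hpos.ne' hN'.ne']
  have h' : ((N : ℝ) + k) * (N + k - 1).choose k = (N + k).choose (k + 1) * (k + 1) := by
    exact_mod_cast h
  linarith

/-- No contraction `M` turns `k` copies of a Haar-random state into `k + 1` copies with expected
fidelity above `(k + 1) / (2 ^ n + k)`. -/
lemma integral_cloning_le {n : ℕ} {E : Type*} [Fintype E]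
    (M : ((Fin k → BitString n) → ℂ) →ₗ[ℂ] ((Fin (k + 1) → BitString n) → E → ℂ))
    (hM : ∀ v, ∑ a, ∑ e, ‖M v a e‖ ^ 2 ≤ ∑ b, ‖v b‖ ^ 2) :
    ∫ ψ, ∑ e, ‖contract (fun a => M (fun b => ∏ j, ψ (b j)) a e) ψ‖ ^ 2 ∂haarState n ≤
      (k + 1) / (2 ^ n + k) := by
  set χ : Sym (BitString n) k → (Fin k → BitString n) → ℂ :=
    fun s a => if symOfFn a = s then (1 : ℂ) else 0
  set m : Sym (BitString n) k → ℝ := fun s => Fintype.card {a // symOfFn a = s}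
  have hm : ∀ s : Sym (BitString n) k, 0 < m s := card_symOfFn_eq_pos
  set D : ℝ := (Nat.multichoose (2 ^ n) (k + 1) : ℝ) with hD
  have hχ : ∀ s, ∑ b, ‖χ s b‖ ^ 2 = m s := fun s => by
    simp only [χ, m, Fintype.card_subtype]
    rw [Finset.card_filter]
    push_cast
    exact Finset.sum_congr rfl fun b _ => by split_ifs <;> simp
  have hint : ∀ s e, Integrable
      (fun ψ => ‖contract (fun a => M (χ s) a e) (WithLp.ofLp ψ)‖ ^ 2 / m s) (haarState n) :=
    fun s e => (integrable_haarState_of_continuous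
      ((continuous_contract _).norm.pow 2)).div_const _
  have hint' : ∀ e, Integrable
      (fun ψ => ∑ s, ‖contract (fun a => M (χ s) a e) (WithLp.ofLp ψ)‖ ^ 2 / m s) (haarState n) :=
    fun e => integrable_finsetSum _ fun s _ => hint s e
  -- Cauchy–Schwarz for each ψ eliminates the k input copies; ψ survives only in the k + 1 copies of
  -- the contraction, where the Haar moment applies.
  calc _ ≤ ∫ ψ, ∑ e, ∑ s, ‖contract (fun a => M (χ s) a e) (WithLp.ofLp ψ)‖ ^ 2 / m s
        ∂haarState n := by
        refine integral_mono_of_nonneg (.of_forall fun ψ => by positivity)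
          (integrable_finsetSum _ fun e _ => hint' e) ?_
        filter_upwards [ae_norm_eq_one_haarState] with ψ hψ
        refine Finset.sum_le_sum fun e _ => ?_
        have h1 : ∑ i, ‖ψ i‖ ^ 2 = 1 := by rw [← EuclideanSpace.norm_sq_eq, hψ, one_pow]
        let C : ((Fin (k + 1) → BitString n) → E → ℂ) →ₗ[ℂ] ℂ :=
          { toFun := fun f => contract (fun a => f a e) ψ
            map_add' := fun f g => by simp [contract, mul_add, Finset.sum_add_distrib]
            map_smul' := fun c f => by
              simp only [contract, Pi.smul_apply, smul_eq_mul, RingHom.id_apply, Finset.mul_sum]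
              exact Finset.sum_congr rfl fun a _ => by ring }
        exact normSq_map_tensorPower_le (WithLp.ofLp ψ) h1 (C ∘ₗ M)
    _ = ∑ e, ∑ s, (∫ ψ, ‖contract (fun a => M (χ s) a e) (WithLp.ofLp ψ)‖ ^ 2 ∂haarState n) /
          m s := by
        rw [integral_finsetSum _ fun e _ => hint' e]
        refine Finset.sum_congr rfl fun e _ => ?_
        rw [integral_finsetSum _ fun s _ => hint s e]
        simp only [integral_div]
    _ ≤ ∑ e, ∑ s, ((∑ a, ‖M (χ s) a e‖ ^ 2) / D) / m s := by
        refine Finset.sum_le_sum fun e _ => Finset.sum_le_sum fun s _ => ?_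
        exact div_le_div_of_nonneg_right (integral_normSq_contract_haarState_le _) (hm s).le
    _ = ∑ s, (∑ a, ∑ e, ‖M (χ s) a e‖ ^ 2) / D / m s := by
        rw [Finset.sum_comm]
        refine Finset.sum_congr rfl fun s _ => ?_
        rw [Finset.sum_comm, Finset.sum_div, Finset.sum_div]
    -- M contracts each normalized basis vector, so each s contributes at most 1 / D, and the number
    -- of s is the dimension of the k-th symmetric power.
    _ ≤ ∑ s : Sym (BitString n) k, 1 / D := by
        refine Finset.sum_le_sum fun s _ => ?_
        rw [div_div, mul_comm, ← div_div]
        refine div_le_div_of_nonneg_right ?_ (Nat.cast_nonneg _)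
        rw [div_le_one (hm s), ← hχ]
        exact hM _
    _ = _ := by
        rw [Finset.sum_const, Finset.card_univ, Sym.card_sym_eq_multichoose, nsmul_eq_mul,
          mul_one_div, hD]
        have := multichoose_div_multichoose (2 ^ n) k (by positivity)
        simpa using this

end CloningWithoutOracle

/-! ### Existence of state preparation laws. -/

section Existence

open scoped ComplexConjugate

variable {n : ℕ}

/-- The unitary `1 - v v† / ⟨v, e₀⟩` with `v = e₀ - ψ`, which maps `e₀ = |0ⁿ⟩` to the unit
vector `ψ`. -/
noncomputable def reflection (ψ : EuclideanSpace ℂ (BitString n)) :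
    Matrix (BitString n) (BitString n) ℂ := fun x y =>
  (if x = y then 1 else 0) - (1 - conj (ψ (zeros n)))⁻¹ *
    ((if x = zeros n then 1 else 0) - ψ x) * conj ((if y = zeros n then 1 else 0) - ψ y)

/-- The degenerate case ψ = e₀: here v = 0, so `reflection` is the identity although its scalar
factor is the default value 0⁻¹ = 0. -/
lemma eq_single_of_apply_eq_one {ψ : EuclideanSpace ℂ (BitString n)} (hψ : ‖ψ‖ = 1)
    (h : ψ (zeros n) = 1) (x : BitString n) : (if x = zeros n then 1 else 0) - ψ x = 0 := by
  split_ifs with hx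
  · rw [hx, h, sub_self]
  · have h1 : ∑ i, ‖ψ i‖ ^ 2 = 1 := by rw [← EuclideanSpace.norm_sq_eq, hψ, one_pow]
    rw [← Finset.add_sum_erase _ _ (Finset.mem_univ (zeros n)), h, norm_one, one_pow] at h1
    have h2 := (Finset.sum_eq_zero_iff_of_nonneg (fun i _ => sq_nonneg _)).1
      (by linarith : ∑ i ∈ Finset.univ.erase (zeros n), ‖ψ i‖ ^ 2 = 0) x
      (Finset.mem_erase.2 ⟨hx, Finset.mem_univ _⟩)
    rw [zero_sub, neg_eq_zero]
    simpa using h2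

lemma reflection_mem_unitaryGroup {ψ : EuclideanSpace ℂ (BitString n)} (hψ : ‖ψ‖ = 1) :
    reflection ψ ∈ Matrix.unitaryGroup (BitString n) ℂ := by
  rw [Matrix.mem_unitaryGroup_iff]
  by_cases h : ψ (zeros n) = 1
  · have : reflection ψ = 1 := by
      ext x y
      simp [reflection, eq_single_of_apply_eq_one hψ h, Matrix.one_apply]
    rw [this, star_one, one_mul]
  · set c := (1 - conj (ψ (zeros n)))⁻¹ with hc
    set v : BitString n → ℂ := fun x => (if x = zeros n then 1 else 0) - ψ x with hv
    have hR : reflection ψ = 1 - c • Matrix.vecMulVec v (star v) := by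
      ext x y
      simp [reflection, Matrix.vecMulVec, Matrix.one_apply, hc, hv, mul_assoc]
    -- This says ‖v‖² = 1/c + 1/c̄, hence |c|²‖v‖² = c + c̄, which is what cancels the cross terms
    -- of (1 - c v v†)(1 - c̄ v v†).
    have hvv : star v ⬝ᵥ v = (1 - ψ (zeros n)) + (1 - conj (ψ (zeros n))) := by
      have h1 : ∑ i, conj (ψ i) * ψ i = 1 := by
        simp only [Complex.conj_mul']
        have : ∑ i, ‖ψ i‖ ^ 2 = 1 := by rw [← EuclideanSpace.norm_sq_eq, hψ, one_pow]
        exact_mod_cast this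
      have h2 : star v ⬝ᵥ v = ∑ i, ((if i = zeros n then (1 - ψ i) - conj (ψ i) else 0) +
          conj (ψ i) * ψ i) := by
        refine Finset.sum_congr rfl fun i _ => ?_
        simp only [hv, Pi.star_apply, RCLike.star_def, map_sub]
        split_ifs <;> simp <;> ring
      rw [h2, Finset.sum_add_distrib, h1]
      simp
      ring
    have h0 : (1 - ψ (zeros n)) ≠ 0 := sub_ne_zero.2 (Ne.symm h)
    have h0' : (1 - conj (ψ (zeros n))) ≠ 0 := by
      have := (map_ne_zero (starRingEnd ℂ)).2 h0
      simpa using this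
    have hcs : star c = (1 - ψ (zeros n))⁻¹ := by simp [hc]
    have hstar : star (Matrix.vecMulVec v (star v)) = Matrix.vecMulVec v (star v) := by
      rw [Matrix.star_eq_conjTranspose, Matrix.conjTranspose_vecMulVec, star_star]
    have hsq : Matrix.vecMulVec v (star v) * Matrix.vecMulVec v (star v) =
        (star v ⬝ᵥ v) • Matrix.vecMulVec v (star v) := by
      rw [Matrix.vecMulVec_mul_vecMulVec]
      ext; simp [Matrix.vecMulVec]; ring
    rw [hR, star_sub, star_one, star_smul, hstar, sub_mul, one_mul, mul_sub, mul_one,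
      Matrix.smul_mul, Matrix.mul_smul, hsq, hvv, smul_smul, smul_smul]
    have : c * (star c * (1 - ψ (zeros n) + (1 - conj (ψ (zeros n))))) = c + star c := by
      rw [hcs, hc]
      field_simp
    rw [mul_assoc, this, add_smul]
    abel

lemma reflection_apply_zeros {ψ : EuclideanSpace ℂ (BitString n)} (hψ : ‖ψ‖ = 1)
    (x : BitString n) : reflection ψ x (zeros n) = ψ x := by
  by_cases h : ψ (zeros n) = 1
  · have := eq_single_of_apply_eq_one hψ h x
    simp only [reflection, this, mul_zero, zero_mul, sub_zero]
    exact sub_eq_zero.1 this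
  · have h0 : (1 - conj (ψ (zeros n))) ≠ 0 := by
      have := (map_ne_zero (starRingEnd ℂ)).2 (sub_ne_zero.2 (Ne.symm h) : 1 - ψ (zeros n) ≠ 0)
      simpa using this
    simp only [reflection, if_true, map_sub, map_one]
    field_simp
    ring

lemma measurable_preparedState : Measurable (preparedState (n := n)) := by
  have : Continuous (preparedState (n := n)) := by
    unfold preparedState
    refine (PiLp.continuous_toLp 2 _).comp (continuous_pi fun x => ?_)
    exact (continuous_subtype_val.matrix_elem x (zeros n))
  exact this.measurable

/-- The Borel σ-algebra of the unitary group is induced from that of matrices, which is the product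
σ-algebra. Entrywise measurability is needed because `reflection` need not be continuous at e₀. -/
lemma measurable_of_measurable_entries {Ω : Type*} [MeasurableSpace Ω] {f : Ω → QubitUnitary n}
    (hf : ∀ x y, Measurable fun ω => (f ω).1 x y) : Measurable f := by
  have hpi : borel (Matrix (BitString n) (BitString n) ℂ) =
      (inferInstance : MeasurableSpace (BitString n → BitString n → ℂ)) :=
    (Pi.borelSpace.measurable_eq (α := BitString n → BitString n → ℂ)).symm
  have hcomap : borel (QubitUnitary n) =
      MeasurableSpace.comap Subtype.val (borel (Matrix (BitString n) (BitString n) ℂ)) :=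
    borel_comap
  have h2 : @Measurable Ω (BitString n → BitString n → ℂ) _ _ fun ω => (f ω).1 :=
    measurable_pi_iff.2 fun x => measurable_pi_iff.2 fun y => hf x y
  intro s hs
  change MeasurableSet[borel (QubitUnitary n)] s at hs
  rw [hcomap] at hs
  obtain ⟨t, ht, rfl⟩ := hs
  rw [hpi] at ht
  exact h2 ht

lemma exists_isStatePreparationLaw (n : ℕ) :
    ∃ μ : Measure (QubitUnitary n), IsStatePreparationLaw μ := by
  set σ := (volume : Measure (EuclideanSpace ℂ (BitString n))).toSphere with hσ
  have hS : ∀ ψ : Metric.sphere (0 : EuclideanSpace ℂ (BitString n)) 1,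
      ‖(ψ : EuclideanSpace ℂ (BitString n))‖ = 1 := fun ψ => by simp
  set U : Metric.sphere (0 : EuclideanSpace ℂ (BitString n)) 1 → QubitUnitary n :=
    fun ψ => ⟨reflection ψ, reflection_mem_unitaryGroup (hS ψ)⟩
  have hc : ∀ x, Measurable fun ψ : Metric.sphere (0 : EuclideanSpace ℂ (BitString n)) 1 =>
      (ψ : EuclideanSpace ℂ (BitString n)) x := fun x =>
    ((EuclideanSpace.proj (𝕜 := ℂ) x).continuous.comp continuous_subtype_val).measurable
  have hconj : Measurable (conj : ℂ → ℂ) := Complex.continuous_conj.measurable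
  have hU : Measurable U := measurable_of_measurable_entries fun x y =>
    measurable_const.sub (((measurable_const.sub (hconj.comp (hc _))).inv.mul
      (measurable_const.sub (hc x))).mul (hconj.comp (measurable_const.sub (hc y))))
  have hprep : Measure.map preparedState (Measure.map U ((σ Set.univ)⁻¹ • σ)) = haarState n := by
    rw [Measure.map_map measurable_preparedState hU, haarState]
    congr 1
    funext ψ
    ext x
    exact reflection_apply_zeros (hS ψ) x
  refine ⟨Measure.map U ((σ Set.univ)⁻¹ • σ), ⟨⟨?_⟩, hprep⟩⟩
  have := (isProbabilityMeasure_haarState n).measure_univ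
  rwa [← hprep, Measure.map_apply measurable_preparedState .univ, Set.preimage_univ] at this

end Existence

/-! ### Fidelity with a pure state as a squared norm. -/

section PureStateFidelity

open scoped MatrixOrder ComplexOrder

/-- The Euclidean norm of a vector of amplitudes. -/
noncomputable def l2norm {B : Type*} [Fintype B] (φ : B → ℂ) : ℝ := ‖WithLp.toLp 2 φ‖

lemma l2norm_sq {B : Type*} [Fintype B] (φ : B → ℂ) : l2norm φ ^ 2 = ∑ x, ‖φ x‖ ^ 2 :=
  EuclideanSpace.norm_sq_eq _

lemma l2norm_nonneg {B : Type*} [Fintype B] (φ : B → ℂ) : 0 ≤ l2norm φ := norm_nonneg _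

lemma l2norm_sub_le {B : Type*} [Fintype B] (φ χ : B → ℂ) :
    l2norm (φ - χ) ≤ l2norm φ + l2norm χ := by
  simpa [l2norm] using norm_sub_le (WithLp.toLp 2 φ) (WithLp.toLp 2 χ)

lemma l2norm_add_le {B : Type*} [Fintype B] (φ χ : B → ℂ) :
    l2norm (φ + χ) ≤ l2norm φ + l2norm χ := by
  simpa [l2norm] using norm_add_le (WithLp.toLp 2 φ) (WithLp.toLp 2 χ)

lemma l2norm_eq_of_sum_eq {B C : Type*} [Fintype B] [Fintype C] {φ : B → ℂ} {χ : C → ℂ}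
    (h : ∑ x, ‖φ x‖ ^ 2 = ∑ y, ‖χ y‖ ^ 2) : l2norm φ = l2norm χ := by
  rw [← l2norm_sq, ← l2norm_sq] at h
  exact (pow_left_inj₀ (l2norm_nonneg _) (l2norm_nonneg _) two_ne_zero).1 h

lemma star_dotProduct_self {B : Type*} [Fintype B] (φ : B → ℂ) : star φ ⬝ᵥ φ = ((∑ x, ‖φ x‖ ^ 2 : ℝ) : ℂ) := by
  push_cast
  exact Finset.sum_congr rfl fun x _ => Complex.conj_mul' _

variable {B : Type} [Fintype B] [DecidableEq B]

lemma l2norm_unitary_mulVec (U : Matrix.unitaryGroup B ℂ) (φ : B → ℂ) :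
    l2norm (U.1 *ᵥ φ) = l2norm φ := by
  refine l2norm_eq_of_sum_eq ?_
  have h : star (U.1 *ᵥ φ) ⬝ᵥ (U.1 *ᵥ φ) = star φ ⬝ᵥ φ := by
    rw [Matrix.star_mulVec, ← Matrix.dotProduct_mulVec, Matrix.mulVec_mulVec,
      ← Matrix.star_eq_conjTranspose, Matrix.mem_unitaryGroup_iff'.1 U.2, Matrix.one_mulVec]
  rw [star_dotProduct_self, star_dotProduct_self] at h
  exact_mod_cast h

/-- For z ≠ 0 the square root of the rank-one matrix z z† is z z† / ‖z‖, whose trace is ‖z‖. -/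
lemma trace_sqrt_vecMulVec (z : B → ℂ) :
    (Matrix.trace (CFC.sqrt (Matrix.vecMulVec z (star z)))).re = l2norm z := by
  have hz : star z ⬝ᵥ z = ((l2norm z ^ 2 : ℝ) : ℂ) := by rw [star_dotProduct_self, l2norm_sq]
  by_cases h : l2norm z = 0
  · have hz0 : z = 0 := by
      have : WithLp.toLp 2 z = 0 := norm_eq_zero.1 h
      simpa using this
    rw [h, hz0, Matrix.zero_vecMulVec, CFC.sqrt_zero, Matrix.trace_zero, Complex.zero_re]
  · have hc : (l2norm z : ℂ) ≠ 0 := by exact_mod_cast h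
    have hsq : CFC.sqrt (Matrix.vecMulVec z (star z)) =
        ((l2norm z)⁻¹ : ℂ) • Matrix.vecMulVec z (star z) := by
      refine CFC.sqrt_unique ?_ ?_
      · rw [Matrix.smul_mul, Matrix.mul_smul, Matrix.vecMulVec_mul_vecMulVec, hz, smul_smul]
        ext i j
        simp only [Matrix.smul_apply, Matrix.vecMulVec_apply, Pi.smul_apply, smul_eq_mul]
        push_cast
        field_simp
      · rw [Matrix.nonneg_iff_posSemidef]
        refine (Matrix.posSemidef_vecMulVec_self_star z).smul ?_
        rw [← Complex.ofReal_inv]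
        exact_mod_cast inv_nonneg.2 (l2norm_nonneg z)
    rw [hsq, Matrix.trace_smul, Matrix.trace_vecMulVec, dotProduct_comm, hz, smul_eq_mul]
    have : (l2norm z : ℂ)⁻¹ * ((l2norm z ^ 2 : ℝ) : ℂ) = (l2norm z : ℂ) := by
      push_cast
      field_simp
    rw [this, Complex.ofReal_re]

/-- With ρ = A A†, the matrix √ρ u u† √ρ is rank one with vector √ρ u, so the fidelity is ‖√ρ u‖² =
⟨u, ρ u⟩ = ‖A† u‖². -/
lemma fidelity_pureState {E : Type*} [Fintype E] (A : Matrix B E ℂ) (u : B → ℂ) :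
    fidelity (A * Aᴴ) (pureState u) = ∑ e, ‖∑ a, star (u a) * A a e‖ ^ 2 := by
  set ρ := A * Aᴴ with hρ
  have hρ0 : 0 ≤ ρ := Matrix.nonneg_iff_posSemidef.2 (Matrix.posSemidef_self_mul_conjTranspose A)
  set s := CFC.sqrt ρ
  have hs : sᴴ = s := (Matrix.nonneg_iff_posSemidef.1 (CFC.sqrt_nonneg ρ)).1
  have hss : s * s = ρ := CFC.sqrt_mul_sqrt_self ρ hρ0
  have h1 : s * pureState u * s = Matrix.vecMulVec (s *ᵥ u) (star (s *ᵥ u)) := by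
    rw [pureState, Matrix.mul_vecMulVec, Matrix.vecMulVec_mul, Matrix.star_mulVec, hs]
  rw [fidelity, h1, trace_sqrt_vecMulVec, l2norm_sq]
  have h2 : star (s *ᵥ u) ⬝ᵥ (s *ᵥ u) = star (Aᴴ *ᵥ u) ⬝ᵥ (Aᴴ *ᵥ u) := by
    rw [Matrix.star_mulVec, Matrix.star_mulVec, ← Matrix.dotProduct_mulVec,
      ← Matrix.dotProduct_mulVec, Matrix.mulVec_mulVec, Matrix.mulVec_mulVec, hs, hss,
      Matrix.conjTranspose_conjTranspose]
  have h3 : star (Aᴴ *ᵥ u) ⬝ᵥ (Aᴴ *ᵥ u) =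
      ((∑ e, ‖∑ a, star (u a) * A a e‖ ^ 2 : ℝ) : ℂ) := by
    push_cast
    refine Finset.sum_congr rfl fun e _ => ?_
    rw [Pi.star_apply, RCLike.star_def, Complex.conj_mul', ← norm_star ((Aᴴ *ᵥ u) e)]
    congr 3
    simp [Matrix.mulVec, dotProduct, mul_comm]
  rw [star_dotProduct_self, h3] at h2
  exact_mod_cast h2

end PureStateFidelity

/-! ### Splitting off registers, partial traces and oracle calls. -/

section Registers

variable {Q R : Type}

/-- The wires that are not selected by `w`. -/
abbrev OtherWires (w : R ↪ Q) : Type := {q : Q // q ∉ Set.range w}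

/-- The bit string on all wires that is `a` on the wires selected by `w` and `e` elsewhere. -/
noncomputable def joinBits (w : R ↪ Q) (a : R → Bool) (e : OtherWires w → Bool) : Q → Bool :=
  -- The default `false` is never read: a wire outside the domain of e is in the range of w.
  Function.extend w a (Function.extend Subtype.val e fun _ => false)

lemma joinBits_apply (w : R ↪ Q) (a : R → Bool) (e : OtherWires w → Bool) (r : R) :
    joinBits w a e (w r) = a r := w.injective.extend_apply _ _ _

lemma joinBits_apply_of_notMem (w : R ↪ Q) (a : R → Bool) (e : OtherWires w → Bool)
    {q : Q} (hq : q ∉ Set.range w) : joinBits w a e q = e ⟨q, hq⟩ := by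
  rw [joinBits, Function.extend_apply' _ _ _ hq]
  exact Subtype.val_injective.extend_apply e _ ⟨q, hq⟩

lemma extend_joinBits (w : R ↪ Q) (a b : R → Bool) (e : OtherWires w → Bool) :
    Function.extend w b (joinBits w a e) = joinBits w b e := by
  funext q
  by_cases hq : q ∈ Set.range w
  · obtain ⟨r, rfl⟩ := hq
    rw [w.injective.extend_apply, joinBits_apply]
  · rw [Function.extend_apply' _ _ _ hq, joinBits_apply_of_notMem _ _ _ hq,
      joinBits_apply_of_notMem _ _ _ hq]

/-- Bit strings on all wires are pairs of bit strings on the selected and on the other wires. -/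
noncomputable def splitBits (w : R ↪ Q) : (R → Bool) × (OtherWires w → Bool) ≃ (Q → Bool) where
  toFun p := joinBits w p.1 p.2
  invFun x := (fun r => x (w r), fun e => x e)
  left_inv p := by
    refine Prod.ext (funext fun r => joinBits_apply _ _ _ _) (funext fun e => ?_)
    exact joinBits_apply_of_notMem _ _ _ e.2
  right_inv x := by
    funext q
    by_cases hq : q ∈ Set.range w
    · obtain ⟨r, rfl⟩ := hq
      exact joinBits_apply _ _ _ _
    · exact joinBits_apply_of_notMem _ _ _ hq

/-- The partial inner product of `u`, on the wires selected by `w`, with `φ`. -/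
noncomputable def partialInner [Fintype R] [DecidableEq R] (w : R ↪ Q) (u : (R → Bool) → ℂ) (φ : (Q → Bool) → ℂ) :
    (OtherWires w → Bool) → ℂ := fun e => ∑ a, star (u a) * φ (joinBits w a e)

lemma partialInner_sub [Fintype R] [DecidableEq R] (w : R ↪ Q) (u : (R → Bool) → ℂ) (φ χ : (Q → Bool) → ℂ) :
    partialInner w u (φ - χ) = partialInner w u φ - partialInner w u χ := by
  funext e
  simp [partialInner, mul_sub, Finset.sum_sub_distrib]

variable {n : ℕ}

/-- The data register among the wires of a query. -/
def dataWires (w : Fin n ⊕ Fin n ↪ Q) : Fin n ↪ Q := Function.Embedding.inr.trans w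

/-- The contents of the index register. -/
def indexBits (w : Fin n ⊕ Fin n ↪ Q) (x : Q → Bool) : BitString n := fun a => x (w (Sum.inl a))

lemma indexBits_joinBits (w : Fin n ⊕ Fin n ↪ Q) (a b : Fin n → Bool)
    (e : OtherWires (dataWires w) → Bool) :
    indexBits w (joinBits (dataWires w) a e) = indexBits w (joinBits (dataWires w) b e) := by
  funext i
  have : w (Sum.inl i) ∉ Set.range (dataWires w) := by
    rintro ⟨j, hj⟩
    exact absurd (w.injective hj) (by simp)
  simp only [indexBits]
  rw [joinBits_apply_of_notMem _ _ _ this, joinBits_apply_of_notMem _ _ _ this]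

/-- The index register lies outside the data register, so its contents depend on e alone and may be
read off with the data set to zero. Hence each e gives a block on which the oracle acts as a single
unitary. -/
lemma applyOracle_joinBits (V : BitString n → QubitUnitary n) (w : Fin n ⊕ Fin n ↪ Q)
    (φ : (Q → Bool) → ℂ) (b : Fin n → Bool) (e : OtherWires (dataWires w) → Bool) :
    applyOracle V w φ (joinBits (dataWires w) b e) =
      ((V (indexBits w (joinBits (dataWires w) (zeros n) e))).1 *ᵥ
        fun b' => φ (joinBits (dataWires w) b' e)) b := by
  rw [indexBits_joinBits w (zeros n) b, applyOracle, Matrix.mulVec, dotProduct]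
  refine Finset.sum_congr rfl fun b' _ => ?_
  have hb : (fun i => joinBits (dataWires w) b e (w (Sum.inr i))) = b :=
    funext fun i => joinBits_apply (dataWires w) b e i
  rw [hb]
  exact congrArg₂ (· * ·) rfl (congrArg φ (extend_joinBits (dataWires w) b b' e))

/-- The oracle call as a linear map. -/
noncomputable def oracleMap (V : BitString n → QubitUnitary n) (w : Fin n ⊕ Fin n ↪ Q) :
    ((Q → Bool) → ℂ) →ₗ[ℂ] ((Q → Bool) → ℂ) where
  toFun := applyOracle V w
  map_add' φ χ := by
    funext x
    simp [applyOracle, mul_add, Finset.sum_add_distrib]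
  map_smul' c φ := by
    funext x
    simp only [applyOracle, Pi.smul_apply, smul_eq_mul, RingHom.id_apply, Finset.mul_sum]
    exact Finset.sum_congr rfl fun b _ => by ring

lemma oracleMap_apply (V : BitString n → QubitUnitary n) (w : Fin n ⊕ Fin n ↪ Q)
    (φ : (Q → Bool) → ℂ) : oracleMap V w φ = applyOracle V w φ := rfl

/-- The component of a state on which the index register holds `J`. -/
def queryPart (w : Fin n ⊕ Fin n ↪ Q) (J : BitString n) (φ : (Q → Bool) → ℂ) :
    (Q → Bool) → ℂ := fun x => if indexBits w x = J then φ x else 0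

/-- The two oracles agree on every block whose index is not J. -/
lemma applyOracle_update_sub (V : BitString n → QubitUnitary n) (J : BitString n)
    (W : QubitUnitary n) (w : Fin n ⊕ Fin n ↪ Q) (φ : (Q → Bool) → ℂ) :
    applyOracle (Function.update V J W) w φ - applyOracle V w φ =
      applyOracle (Function.update V J W) w (queryPart w J φ) -
        applyOracle V w (queryPart w J φ) := by
  funext x
  obtain ⟨⟨b, e⟩, rfl⟩ := (splitBits (dataWires w)).surjective x
  change applyOracle _ w φ (joinBits _ b e) - applyOracle _ w φ (joinBits _ b e) =
    applyOracle _ w _ (joinBits _ b e) - applyOracle _ w _ (joinBits _ b e)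
  simp only [applyOracle_joinBits]
  by_cases h : indexBits w (joinBits (dataWires w) (zeros n) e) = J
  · have : (fun b' => queryPart w J φ (joinBits (dataWires w) b' e)) =
        fun b' => φ (joinBits (dataWires w) b' e) := by
      funext b'
      rw [queryPart, indexBits_joinBits w b' (zeros n), if_pos h]
    rw [this]
  · rw [Function.update_of_ne h, sub_self, sub_self]

variable [Fintype Q] [DecidableEq Q] [Fintype R] [DecidableEq R]

lemma sum_joinBits {M : Type*} [AddCommMonoid M] (w : R ↪ Q) (f : (Q → Bool) → M) :
    ∑ x, f x = ∑ e, ∑ a, f (joinBits w a e) := by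
  rw [← (splitBits w).sum_comp, Fintype.sum_prod_type_right]
  rfl

/-- Arranging the amplitudes as a matrix with the traced-out wires as columns puts the partial trace
in the form A A† required by `fidelity_pureState`. -/
lemma reducedState_eq (w : R ↪ Q) (φ : (Q → Bool) → ℂ) :
    reducedState w φ = (Matrix.of fun a e => φ (joinBits w a e)) *
      (Matrix.of fun a e => φ (joinBits w a e))ᴴ := by
  ext a b
  rw [reducedState, sum_joinBits w, Matrix.mul_apply]
  refine Finset.sum_congr rfl fun e _ => ?_
  simp [joinBits_apply, extend_joinBits]

lemma fidelity_reducedState (w : R ↪ Q) (u : (R → Bool) → ℂ) (φ : (Q → Bool) → ℂ) :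
    fidelity (reducedState w φ) (pureState u) = l2norm (partialInner w u φ) ^ 2 := by
  rw [reducedState_eq, fidelity_pureState, l2norm_sq]
  rfl

lemma l2norm_partialInner_le (w : R ↪ Q) (u : (R → Bool) → ℂ) (φ : (Q → Bool) → ℂ)
    (hu : l2norm u = 1) : l2norm (partialInner w u φ) ≤ l2norm φ := by
  refine le_of_sq_le_sq ?_ (l2norm_nonneg _)
  rw [l2norm_sq, l2norm_sq, sum_joinBits w]
  refine Finset.sum_le_sum fun e _ => ?_
  have h1 : ∑ a, ‖u a‖ ^ 2 = 1 := by rw [← l2norm_sq, hu, one_pow]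
  calc _ ≤ (∑ a, ‖u a‖ * ‖φ (joinBits w a e)‖) ^ 2 := by
        refine pow_le_pow_left₀ (norm_nonneg _) ((norm_sum_le _ _).trans_eq ?_) 2
        simp only [norm_mul, norm_star]
    _ ≤ (∑ a, ‖u a‖ ^ 2) * ∑ a, ‖φ (joinBits w a e)‖ ^ 2 :=
        Finset.sum_mul_sq_le_sq_mul_sq _ _ _
    _ = _ := by rw [h1, one_mul]

lemma l2norm_applyOracle (V : BitString n → QubitUnitary n) (w : Fin n ⊕ Fin n ↪ Q)
    (φ : (Q → Bool) → ℂ) : l2norm (applyOracle V w φ) = l2norm φ := by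
  refine l2norm_eq_of_sum_eq ?_
  rw [sum_joinBits (dataWires w), sum_joinBits (dataWires w)]
  refine Finset.sum_congr rfl fun e _ => ?_
  simp only [applyOracle_joinBits]
  rw [← l2norm_sq, ← l2norm_sq, l2norm_unitary_mulVec]

lemma l2norm_applyOracle_update_sub_le (V : BitString n → QubitUnitary n) (J : BitString n)
    (W : QubitUnitary n) (w : Fin n ⊕ Fin n ↪ Q) (φ : (Q → Bool) → ℂ) :
    l2norm (applyOracle (Function.update V J W) w φ - applyOracle V w φ) ≤
      2 * l2norm (queryPart w J φ) := by
  rw [applyOracle_update_sub]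
  refine (l2norm_sub_le _ _).trans_eq ?_
  rw [l2norm_applyOracle, l2norm_applyOracle, two_mul]

/-- The components for different J are orthogonal and sum to φ, so their squared norms add up to
‖φ‖²; Cauchy–Schwarz over the 2^n indices does the rest. -/
lemma sum_l2norm_queryPart_le (w : Fin n ⊕ Fin n ↪ Q) (φ : (Q → Bool) → ℂ) :
    ∑ J, l2norm (queryPart w J φ) ≤ √(2 ^ n) * l2norm φ := by
  have h1 : ∑ J, l2norm (queryPart w J φ) ^ 2 = l2norm φ ^ 2 := by
    simp only [l2norm_sq]
    rw [Finset.sum_comm]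
    refine Finset.sum_congr rfl fun x _ => ?_
    rw [Finset.sum_eq_single (indexBits w x)]
    · rw [queryPart, if_pos rfl]
    · intro J _ hJ
      rw [queryPart, if_neg hJ.symm, norm_zero, zero_pow two_ne_zero]
    · simp
  refine le_of_sq_le_sq ?_ (mul_nonneg (Real.sqrt_nonneg _) (l2norm_nonneg _))
  have h2 := sq_sum_le_card_mul_sum_sq (s := Finset.univ) (f := fun J => l2norm (queryPart w J φ))
  rw [h1] at h2
  rw [mul_pow, Real.sq_sqrt (by positivity)]
  simpa using h2

end Registers

/-! ### The algorithm as a linear isometry, and its performance on an independent input. -/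

namespace QueryAlgorithm

variable {n k m T : ℕ}

/-- The isometry `|v⟩ ↦ |v⟩|0^m⟩` from `k` registers to all wires. -/
noncomputable def adjoinAncillas (n k m : ℕ) :
    ((Fin k → BitString n) → ℂ) →ₗ[ℂ] ((Wire n k m → Bool) → ℂ) where
  toFun v x := if ∀ a, x (Sum.inr a) = false then v (fun j a => x (Sum.inl (j, a))) else 0
  map_add' v v' := by
    funext x
    simp only [Pi.add_apply]
    split_ifs <;> simp
  map_smul' c v := by
    funext x
    simp

lemma initialState_eq (ψ : EuclideanSpace ℂ (BitString n)) :
    (initialState ψ : (Wire n k m → Bool) → ℂ) =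
      adjoinAncillas n k m (fun b => ∏ j, ψ (b j)) := rfl

lemma l2norm_adjoinAncillas (v : (Fin k → BitString n) → ℂ) :
    l2norm (adjoinAncillas n k m v) = l2norm v := by
  refine l2norm_eq_of_sum_eq ?_
  rw [← (Equiv.sumArrowEquivProdArrow (Fin k × Fin n) (Fin m) Bool).symm.sum_comp,
    Fintype.sum_prod_type, ← (Equiv.curry (Fin k) (Fin n) Bool).sum_comp]
  refine Finset.sum_congr rfl fun y _ => ?_
  rw [Finset.sum_eq_single fun _ => false]
  · simp [adjoinAncillas, Equiv.sumArrowEquivProdArrow, Equiv.curry]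
    rfl
  · intro z _ hz
    have : ¬ ∀ a, z a = false := fun h => hz (funext h)
    have h0 : adjoinAncillas n k m v
        ((Equiv.sumArrowEquivProdArrow (Fin k × Fin n) (Fin m) Bool).symm (y, z)) = 0 :=
      if_neg this
    rw [h0, norm_zero, zero_pow two_ne_zero]
  · simp

/-- The evolution of the state of all wires during the first `t` queries. -/
noncomputable def evolution (A : QueryAlgorithm n k m T) (V : BitString n → QubitUnitary n)
    (t : Fin (T + 1)) : ((Wire n k m → Bool) → ℂ) →ₗ[ℂ] ((Wire n k m → Bool) → ℂ) :=
  Fin.induction (motive := fun _ => ((Wire n k m → Bool) → ℂ) →ₗ[ℂ] ((Wire n k m → Bool) → ℂ))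
    (A.unitary 0).1.mulVecLin
    (fun s L => (A.unitary s.succ).1.mulVecLin ∘ₗ oracleMap V (A.queryWires s) ∘ₗ L) t

lemma stateAfter_zero (A : QueryAlgorithm n k m T) (V : BitString n → QubitUnitary n)
    (ψ : EuclideanSpace ℂ (BitString n)) :
    A.stateAfter V ψ 0 = (A.unitary 0).1 *ᵥ initialState ψ := rfl

lemma stateAfter_succ (A : QueryAlgorithm n k m T) (V : BitString n → QubitUnitary n)
    (ψ : EuclideanSpace ℂ (BitString n)) (s : Fin T) :
    A.stateAfter V ψ s.succ =
      (A.unitary s.succ).1 *ᵥ applyOracle V (A.queryWires s) (A.stateAfter V ψ s.castSucc) := by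
  rw [stateAfter, Fin.induction_succ]
  rfl

lemma evolution_succ (A : QueryAlgorithm n k m T) (V : BitString n → QubitUnitary n)
    (φ : (Wire n k m → Bool) → ℂ) (s : Fin T) :
    A.evolution V s.succ φ =
      (A.unitary s.succ).1 *ᵥ applyOracle V (A.queryWires s) (A.evolution V s.castSucc φ) := by
  rw [evolution, Fin.induction_succ]
  rfl

/-- For a fixed oracle the final state is linear in the input, which makes `integral_cloning_le`
applicable. -/
lemma stateAfter_eq (A : QueryAlgorithm n k m T) (V : BitString n → QubitUnitary n)
    (ψ : EuclideanSpace ℂ (BitString n)) (t : Fin (T + 1)) :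
    A.stateAfter V ψ t = A.evolution V t (initialState ψ) := by
  induction t using Fin.induction with
  | zero => rfl
  | succ s ih => rw [stateAfter_succ, evolution_succ, ih]

lemma l2norm_evolution (A : QueryAlgorithm n k m T) (V : BitString n → QubitUnitary n)
    (φ : (Wire n k m → Bool) → ℂ) (t : Fin (T + 1)) : l2norm (A.evolution V t φ) = l2norm φ := by
  induction t using Fin.induction with
  | zero => exact l2norm_unitary_mulVec _ _
  | succ s ih => rw [evolution_succ, l2norm_unitary_mulVec, l2norm_applyOracle, ih]

lemma l2norm_tensorPower (k : ℕ) {ψ : EuclideanSpace ℂ (BitString n)} (hψ : ‖ψ‖ = 1) :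
    l2norm (fun b : Fin k → BitString n => ∏ j, ψ (b j)) = 1 := by
  have h := l2norm_sq (fun b : Fin k → BitString n => ∏ j, ψ (b j))
  rw [sum_normSq_prod_comp, ← EuclideanSpace.norm_sq_eq, hψ, one_pow, one_pow] at h
  exact (pow_eq_one_iff_of_nonneg (l2norm_nonneg _) two_ne_zero).1 h

lemma l2norm_copies (k : ℕ) {ψ : EuclideanSpace ℂ (BitString n)} (hψ : ‖ψ‖ = 1) :
    l2norm (copies k ψ) = 1 := by
  rw [← l2norm_tensorPower k hψ]
  refine l2norm_eq_of_sum_eq ?_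
  rw [← (Equiv.curry (Fin k) (Fin n) Bool).sum_comp]
  rfl

lemma l2norm_stateAfter (A : QueryAlgorithm n k m T) (V : BitString n → QubitUnitary n)
    {ψ : EuclideanSpace ℂ (BitString n)} (hψ : ‖ψ‖ = 1) (t : Fin (T + 1)) :
    l2norm (A.stateAfter V ψ t) = 1 := by
  rw [stateAfter_eq, l2norm_evolution, initialState_eq, l2norm_adjoinAncillas,
    l2norm_tensorPower k hψ]

/-- The fidelity of the output with `|ψ⟩^{⊗ (k + 1)}`, for an arbitrary input state `ψ`. -/
noncomputable def overlap (A : QueryAlgorithm n k m T) (V : BitString n → QubitUnitary n)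
    (ψ : EuclideanSpace ℂ (BitString n)) : ℝ :=
  l2norm (partialInner A.outputWires (copies (k + 1) ψ) (A.stateAfter V ψ (Fin.last T))) ^ 2

/-- Separates the two roles of V_J, as an oracle entry and as the source of the input, so that they
can be varied independently. -/
lemma cloningFidelity_eq (A : QueryAlgorithm n k m T) (V : BitString n → QubitUnitary n)
    (J : BitString n) : A.cloningFidelity V J = A.overlap V (preparedState (V J)) :=
  fidelity_reducedState _ _ _

lemma overlap_nonneg (A : QueryAlgorithm n k m T) (V : BitString n → QubitUnitary n)
    (ψ : EuclideanSpace ℂ (BitString n)) : 0 ≤ A.overlap V ψ := sq_nonneg _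

lemma overlap_le_one (A : QueryAlgorithm n k m T) (V : BitString n → QubitUnitary n)
    {ψ : EuclideanSpace ℂ (BitString n)} (hψ : ‖ψ‖ = 1) : A.overlap V ψ ≤ 1 := by
  refine pow_le_one₀ (l2norm_nonneg _) ?_
  exact (l2norm_partialInner_le _ _ _ (l2norm_copies _ hψ)).trans_eq (l2norm_stateAfter A V hψ _)

lemma norm_preparedState (V : QubitUnitary n) : ‖preparedState V‖ = 1 := by
  have h := l2norm_unitary_mulVec V (Pi.single (zeros n) 1)
  have h1 : V.1 *ᵥ Pi.single (zeros n) 1 = fun x => V.1 x (zeros n) := by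
    rw [Matrix.mulVec_single_one]
    rfl
  rw [h1] at h
  have h2 : l2norm (Pi.single (zeros n) (1 : ℂ)) = 1 := by
    have h3 := l2norm_sq (Pi.single (zeros n) (1 : ℂ))
    rw [Finset.sum_eq_single (zeros n)] at h3
    · rw [Pi.single_eq_same, norm_one, one_pow] at h3
      exact (pow_eq_one_iff_of_nonneg (l2norm_nonneg _) two_ne_zero).1 h3
    · intro b _ hb
      rw [Pi.single_eq_of_ne hb, norm_zero, zero_pow two_ne_zero]
    · simp
  rw [h2] at h
  exact h

/-- An oracle that is independent of the Haar-random input state does not help to clone it. -/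
lemma integral_overlap_le (A : QueryAlgorithm n k m T) (V : BitString n → QubitUnitary n) :
    ∫ ψ, A.overlap V ψ ∂haarState n ≤ (k + 1) / (2 ^ n + k) := by
  let M : ((Fin k → BitString n) → ℂ) →ₗ[ℂ]
      ((Fin (k + 1) → BitString n) → (OtherWires A.outputWires → Bool) → ℂ) :=
    { toFun := fun v a e => A.evolution V (Fin.last T) (adjoinAncillas n k m v)
        (joinBits A.outputWires (fun p => a p.1 p.2) e)
      map_add' := fun v v' => by
        funext a e
        simp only [map_add, Pi.add_apply]
      map_smul' := fun c v => by
        funext a e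
        simp only [map_smul, Pi.smul_apply, RingHom.id_apply] }
  -- Equality holds: adjoining ancillas and evolving are isometries, and splitting the output wires
  -- only reindexes the amplitudes.
  have hM : ∀ v, ∑ a, ∑ e, ‖M v a e‖ ^ 2 ≤ ∑ b, ‖v b‖ ^ 2 := fun v => by
    rw [← l2norm_sq v, ← l2norm_adjoinAncillas (m := m), ← l2norm_evolution A V _ (Fin.last T),
      l2norm_sq, sum_joinBits A.outputWires, Finset.sum_comm]
    refine (Finset.sum_congr rfl fun e _ => ?_).le
    rw [← (Equiv.curry (Fin (k + 1)) (Fin n) Bool).sum_comp]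
    rfl
  refine le_trans (le_of_eq ?_) (integral_cloning_le M hM)
  refine integral_congr_ae (.of_forall fun ψ => ?_)
  simp only [overlap]
  rw [l2norm_sq]
  refine Finset.sum_congr rfl fun e _ => ?_
  rw [partialInner, contract, ← (Equiv.curry (Fin (k + 1)) (Fin n) Bool).sum_comp]
  congr 2
  refine Finset.sum_congr rfl fun a _ => ?_
  rw [stateAfter_eq, initialState_eq, copies, RCLike.star_def, map_prod]
  rfl

/-! ### The hybrid argument. -/

/-- The weight of the queries to the index `J`. -/
noncomputable def queryWeight (A : QueryAlgorithm n k m T) (V : BitString n → QubitUnitary n)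
    (ψ : EuclideanSpace ℂ (BitString n)) (J : BitString n) : ℝ :=
  ∑ s : Fin T, l2norm (queryPart (A.queryWires s) J (A.stateAfter V ψ s.castSucc))

lemma le_sum_of_succ_le {T : ℕ} (d : Fin (T + 1) → ℝ) (ε : Fin T → ℝ) (h0 : d 0 = 0)
    (h : ∀ s : Fin T, d s.succ ≤ d s.castSucc + ε s) : d (Fin.last T) ≤ ∑ s, ε s := by
  induction T with
  | zero => simp [h0]
  | succ T ih =>
    rw [Fin.sum_univ_castSucc]
    have := ih (fun t => d t.castSucc) (fun s => ε s.castSucc) h0 fun s => h s.castSucc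
    exact (h (Fin.last T)).trans (add_le_add_left this _)

/-- The hybrid argument: changing the oracle at the index `J` changes the final state by at most
twice the query weight at `J`. -/
lemma l2norm_stateAfter_update_sub_le (A : QueryAlgorithm n k m T)
    (V : BitString n → QubitUnitary n) (J : BitString n) (W : QubitUnitary n)
    (ψ : EuclideanSpace ℂ (BitString n)) :
    l2norm (A.stateAfter (Function.update V J W) ψ (Fin.last T) -
      A.stateAfter V ψ (Fin.last T)) ≤ 2 * A.queryWeight V ψ J := by
  rw [queryWeight, Finset.mul_sum]
  refine le_sum_of_succ_le (fun t => l2norm (A.stateAfter (Function.update V J W) ψ t -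
    A.stateAfter V ψ t)) _ ?_ fun s => ?_
  · simp only [stateAfter_zero, sub_self]
    exact norm_zero
  · simp only [stateAfter_succ]
    rw [← Matrix.mulVec_sub, l2norm_unitary_mulVec]
    set φ := A.stateAfter V ψ s.castSucc
    set χ := A.stateAfter (Function.update V J W) ψ s.castSucc
    -- The old error χ - φ is carried along isometrically by the modified oracle; the new error is
    -- created on φ, the state of the unmodified run. Hence only query weights of the run on V
    -- appear.
    have h : applyOracle (Function.update V J W) (A.queryWires s) χ -
        applyOracle V (A.queryWires s) φ =
        applyOracle (Function.update V J W) (A.queryWires s) (χ - φ) +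
          (applyOracle (Function.update V J W) (A.queryWires s) φ -
            applyOracle V (A.queryWires s) φ) := by
      simp only [← oracleMap_apply, map_sub]
      abel
    rw [h]
    refine (l2norm_add_le _ _).trans (add_le_add ?_ (l2norm_applyOracle_update_sub_le _ _ _ _ _))
    rw [l2norm_applyOracle]

lemma overlap_update_le (A : QueryAlgorithm n k m T) (V : BitString n → QubitUnitary n)
    (J : BitString n) (W : QubitUnitary n) {ψ : EuclideanSpace ℂ (BitString n)} (hψ : ‖ψ‖ = 1) :
    A.overlap (Function.update V J W) ψ ≤ A.overlap V ψ + 4 * A.queryWeight V ψ J := by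
  set u := copies (k + 1) ψ
  have hu : l2norm u = 1 := l2norm_copies _ hψ
  set x := l2norm (partialInner A.outputWires u
    (A.stateAfter (Function.update V J W) ψ (Fin.last T))) with hx
  set y := l2norm (partialInner A.outputWires u (A.stateAfter V ψ (Fin.last T))) with hy
  have hx1 : x ≤ 1 := (l2norm_partialInner_le _ _ _ hu).trans_eq (l2norm_stateAfter A _ hψ _)
  have hy1 : y ≤ 1 := (l2norm_partialInner_le _ _ _ hu).trans_eq (l2norm_stateAfter A _ hψ _)
  have hx0 : 0 ≤ x := l2norm_nonneg _
  have hy0 : 0 ≤ y := l2norm_nonneg _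
  have hw : 0 ≤ A.queryWeight V ψ J := Finset.sum_nonneg fun s _ => l2norm_nonneg _
  have hxy : x ≤ y + 2 * A.queryWeight V ψ J := by
    have h1 := l2norm_add_le (partialInner A.outputWires u (A.stateAfter V ψ (Fin.last T)))
      (partialInner A.outputWires u (A.stateAfter (Function.update V J W) ψ (Fin.last T) -
        A.stateAfter V ψ (Fin.last T)))
    rw [partialInner_sub, add_sub_cancel, ← partialInner_sub] at h1
    exact h1.trans (add_le_add le_rfl ((l2norm_partialInner_le _ _ _ hu).trans
      (l2norm_stateAfter_update_sub_le A V J W ψ)))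
  -- The constant 4 comes from x² - y² = (x + y)(x - y), with x + y ≤ 2 and x - y at most twice the
  -- query weight.
  change x ^ 2 ≤ y ^ 2 + 4 * A.queryWeight V ψ J
  nlinarith

/-- The run on V is the same for all J, so at each query the parts for different J belong to one
unit vector. -/
lemma sum_queryWeight_le (A : QueryAlgorithm n k m T) (V : BitString n → QubitUnitary n)
    {ψ : EuclideanSpace ℂ (BitString n)} (hψ : ‖ψ‖ = 1) :
    ∑ J, A.queryWeight V ψ J ≤ T * √(2 ^ n) := by
  simp only [queryWeight]
  rw [Finset.sum_comm]
  calc _ ≤ ∑ s : Fin T, √(2 ^ n) := Finset.sum_le_sum fun s _ => by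
        refine (sum_l2norm_queryPart_le _ _).trans_eq ?_
        rw [l2norm_stateAfter A V hψ, mul_one]
    _ = _ := by simp

end QueryAlgorithm

namespace QueryAlgorithm

variable {n k m T : ℕ}

/-! ### Measurability of the quantities to be averaged. -/

section Measurability

variable {Ω : Type*} [MeasurableSpace Ω] {V : Ω → BitString n → QubitUnitary n}
  {ψ : Ω → EuclideanSpace ℂ (BitString n)}

lemma measurable_entry (x y : BitString n) : Measurable fun U : QubitUnitary n => U.1 x y :=
  (continuous_subtype_val.matrix_elem x y).measurable

lemma measurable_amplitude (hψ : Measurable ψ) (x : BitString n) : Measurable fun ω => ψ ω x :=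
  (EuclideanSpace.proj (𝕜 := ℂ) x).continuous.measurable.comp hψ

lemma measurable_copies (hψ : Measurable ψ) (k : ℕ) (x : Fin k × Fin n → Bool) :
    Measurable fun ω => copies k (ψ ω) x :=
  Finset.measurable_fun_prod _ fun _ _ => measurable_amplitude hψ _

lemma measurable_stateAfter (A : QueryAlgorithm n k m T) (hV : Measurable V) (hψ : Measurable ψ)
    (t : Fin (T + 1)) (x : Wire n k m → Bool) :
    Measurable fun ω => A.stateAfter (V ω) (ψ ω) t x := by
  induction t using Fin.induction generalizing x with
  | zero =>
    simp only [stateAfter_zero, Matrix.mulVec, dotProduct]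
    refine Finset.measurable_fun_sum _ fun y _ => measurable_const.mul ?_
    unfold initialState
    split_ifs
    · exact measurable_copies hψ _ _
    · exact measurable_const
  | succ s ih =>
    have hVi : ∀ i a b, Measurable fun ω => (V ω i).1 a b := fun i a b =>
      (measurable_entry a b).comp ((measurable_pi_apply i).comp hV)
    simp only [stateAfter_succ, Matrix.mulVec, dotProduct, applyOracle]
    exact Finset.measurable_fun_sum _ fun y _ => measurable_const.mul <|
      Finset.measurable_fun_sum _ fun b _ =>
        (hVi _ _ _).mul (ih _)

lemma measurable_l2norm {B : Type*} [Fintype B] {φ : Ω → B → ℂ}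
    (hφ : ∀ x, Measurable fun ω => φ ω x) : Measurable fun ω => l2norm (φ ω) := by
  have : ∀ ω, l2norm (φ ω) = √(∑ x, ‖φ ω x‖ ^ 2) := fun ω => by
    rw [← l2norm_sq, Real.sqrt_sq (l2norm_nonneg _)]
  simp only [this]
  exact (Finset.measurable_fun_sum _ fun x _ => (hφ x).norm.pow_const 2).sqrt

lemma measurable_overlap (A : QueryAlgorithm n k m T) (hV : Measurable V) (hψ : Measurable ψ) :
    Measurable fun ω => A.overlap (V ω) (ψ ω) := by
  refine (measurable_l2norm fun e => ?_).pow_const 2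
  refine Finset.measurable_fun_sum _ fun a _ => Measurable.mul ?_ (measurable_stateAfter A hV hψ _ _)
  exact (continuous_star.measurable).comp (measurable_copies hψ _ _)

lemma measurable_queryWeight (A : QueryAlgorithm n k m T) (hV : Measurable V) (hψ : Measurable ψ)
    (J : BitString n) : Measurable fun ω => A.queryWeight (V ω) (ψ ω) J := by
  refine Finset.measurable_fun_sum _ fun s _ => measurable_l2norm fun x => ?_
  unfold queryPart
  split_ifs
  · exact measurable_stateAfter A hV hψ _ _
  · exact measurable_const

end Measurability

lemma queryWeight_nonneg (A : QueryAlgorithm n k m T) (V : BitString n → QubitUnitary n)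
    (ψ : EuclideanSpace ℂ (BitString n)) (J : BitString n) : 0 ≤ A.queryWeight V ψ J :=
  Finset.sum_nonneg fun _ _ => l2norm_nonneg _

lemma queryWeight_le (A : QueryAlgorithm n k m T) (V : BitString n → QubitUnitary n)
    {ψ : EuclideanSpace ℂ (BitString n)} (hψ : ‖ψ‖ = 1) (J : BitString n) :
    A.queryWeight V ψ J ≤ T * √(2 ^ n) :=
  (Finset.single_le_sum (fun J _ => queryWeight_nonneg A V ψ J) (Finset.mem_univ J)).trans
    (sum_queryWeight_le A V hψ)

/-- Resampling one coordinate of a random vector with independent coordinates. -/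
lemma measurePreserving_update {ι : Type*} [Fintype ι] [DecidableEq ι] {X : Type*}
    [MeasurableSpace X] (μ : ι → Measure X) [∀ i, IsProbabilityMeasure (μ i)] (j : ι) :
    MeasurePreserving (fun p : (ι → X) × X => Function.update p.1 j p.2)
      ((Measure.pi μ).prod (μ j)) (Measure.pi μ) := by
  have hmeas : Measurable fun p : (ι → X) × X => Function.update p.1 j p.2 := by
    refine measurable_pi_iff.2 fun i => ?_
    by_cases h : i = j
    · subst h
      simpa using measurable_snd
    · have : Measurable fun p : (ι → X) × X => p.1 i :=
        (measurable_pi_apply i).comp measurable_fst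
      simpa [Function.update_of_ne h] using this
  refine ⟨hmeas, (Measure.pi_eq fun s hs => ?_).symm⟩
  rw [Measure.map_apply hmeas (MeasurableSet.univ_pi hs)]
  have : (fun p : (ι → X) × X => Function.update p.1 j p.2) ⁻¹' Set.univ.pi s =
      (Set.univ.pi (Function.update s j Set.univ)) ×ˢ s j := by
    ext p
    simp only [Set.mem_preimage, Set.mem_univ_pi, Set.mem_prod]
    constructor
    · refine fun h => ⟨fun i => ?_, by simpa using h j⟩
      by_cases hi : i = j
      · subst hi
        simp
      · simpa [Function.update_of_ne hi] using h i
    · rintro ⟨h, hj⟩ i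
      by_cases hi : i = j
      · subst hi
        simpa using hj
      · simpa [Function.update_of_ne hi] using h i
  rw [this, Measure.prod_prod, Measure.pi_pi,
    ← Finset.mul_prod_erase _ _ (Finset.mem_univ j), Function.update_self, measure_univ, one_mul,
    mul_comm, ← Finset.mul_prod_erase _ (fun i => μ i (s i)) (Finset.mem_univ j)]
  congr 1
  refine Finset.prod_congr rfl fun i hi => ?_
  rw [Function.update_of_ne (Finset.ne_of_mem_erase hi)]

/-! ### Averaging over the oracle and the index. -/

variable {μ : BitString n → Measure (QubitUnitary n)}

lemma integrable_cloningFidelity [∀ i, IsProbabilityMeasure (μ i)] (A : QueryAlgorithm n k m T)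
    (J : BitString n) : Integrable (fun V => A.cloningFidelity V J) (Measure.pi μ) := by
  simp only [cloningFidelity_eq]
  refine Integrable.of_bound (C := 1) (measurable_overlap A measurable_id
    (measurable_preparedState.comp (measurable_pi_apply J))).aestronglyMeasurable
    (.of_forall fun V => ?_)
  rw [Real.norm_of_nonneg (overlap_nonneg _ _ _)]
  exact overlap_le_one _ _ (norm_preparedState _)

lemma integrable_overlap (P : Measure (BitString n → QubitUnitary n)) [IsProbabilityMeasure P]
    (A : QueryAlgorithm n k m T) :
    Integrable (fun p => A.overlap p.1 p.2) (P.prod (haarState n)) := by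
  refine Integrable.of_bound (C := 1) (measurable_overlap A measurable_fst
    measurable_snd).aestronglyMeasurable ?_
  filter_upwards [Measure.quasiMeasurePreserving_snd.ae ae_norm_eq_one_haarState] with p hp
  rw [Real.norm_of_nonneg (overlap_nonneg _ _ _)]
  exact overlap_le_one _ _ hp

lemma integrable_queryWeight (P : Measure (BitString n → QubitUnitary n)) [IsProbabilityMeasure P]
    (A : QueryAlgorithm n k m T) (J : BitString n) :
    Integrable (fun p => A.queryWeight p.1 p.2 J) (P.prod (haarState n)) := by
  refine Integrable.of_bound (C := T * √(2 ^ n)) (measurable_queryWeight A measurable_fst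
    measurable_snd J).aestronglyMeasurable ?_
  filter_upwards [Measure.quasiMeasurePreserving_snd.ae ae_norm_eq_one_haarState] with p hp
  rw [Real.norm_of_nonneg (queryWeight_nonneg _ _ _ _)]
  exact queryWeight_le _ _ hp _

/-- Resample V_J as W and undo the substitution in the oracle by `overlap_update_le`. The resulting
bound sees W only through W|0^n⟩, so of the law of W only the Haar property matters, not the choice
of the other columns. -/
lemma integral_cloningFidelity_le (hμ : ∀ i, IsStatePreparationLaw (μ i))
    [∀ i, IsProbabilityMeasure (μ i)] (A : QueryAlgorithm n k m T) (J : BitString n) :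
    ∫ V, A.cloningFidelity V J ∂Measure.pi μ ≤
      ∫ p, A.overlap p.1 p.2 + 4 * A.queryWeight p.1 p.2 J
        ∂(Measure.pi μ).prod (haarState n) := by
  have hupd := measurePreserving_update μ J
  have hprep : MeasurePreserving (Prod.map id preparedState)
      ((Measure.pi μ).prod (μ J)) ((Measure.pi μ).prod (haarState n)) :=
    (MeasurePreserving.id _).prod ⟨measurable_preparedState, (hμ J).map_preparedState⟩
  have hint := (integrable_overlap (Measure.pi μ) A).add
    ((integrable_queryWeight (Measure.pi μ) A J).const_mul 4)
  rw [← hupd.map_eq, integral_map hupd.measurable.aemeasurable (by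
    rw [hupd.map_eq]
    exact (integrable_cloningFidelity A J).aestronglyMeasurable), hupd.map_eq, ← hprep.map_eq,
    integral_map hprep.measurable.aemeasurable (by
      rw [hprep.map_eq]
      exact hint.aestronglyMeasurable)]
  refine integral_mono_of_nonneg (.of_forall fun p => ?_) (hprep.integrable_comp_of_integrable hint)
    (.of_forall fun p => ?_)
  · simp only [cloningFidelity_eq]
    exact overlap_nonneg _ _ _
  · simp only [cloningFidelity_eq, Function.update_self, Prod.map_fst, Prod.map_snd, id]
    exact overlap_update_le _ _ _ _ (norm_preparedState _)

/-- The sharper bound from which the theorem follows. -/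
lemma sum_integral_cloningFidelity_le (hμ : ∀ i, IsStatePreparationLaw (μ i))
    [∀ i, IsProbabilityMeasure (μ i)] (A : QueryAlgorithm n k m T) :
    ∑ J, ∫ V, A.cloningFidelity V J ∂Measure.pi μ ≤
      2 ^ n * ((k + 1) / (2 ^ n + k)) + 4 * (T * √(2 ^ n)) := by
  set P := Measure.pi μ
  have ho := integrable_overlap P A
  have hq := integrable_queryWeight P A
  calc _ ≤ ∑ J, ∫ p, A.overlap p.1 p.2 + 4 * A.queryWeight p.1 p.2 J ∂P.prod (haarState n) :=
        Finset.sum_le_sum fun J _ => integral_cloningFidelity_le hμ A J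
    _ = 2 ^ n * (∫ p, A.overlap p.1 p.2 ∂P.prod (haarState n)) +
          4 * ∫ p, ∑ J, A.queryWeight p.1 p.2 J ∂P.prod (haarState n) := by
        rw [integral_finsetSum _ fun J _ => hq J, Finset.mul_sum]
        simp only [integral_add ho ((hq _).const_mul 4), integral_const_mul]
        rw [Finset.sum_add_distrib]
        simp
    -- The overlap is bounded by integrating over ψ for each fixed V, the query weights by their
    -- pointwise sum over J.
    _ ≤ _ := by
        refine add_le_add (mul_le_mul_of_nonneg_left ?_ (by positivity))
          (mul_le_mul_of_nonneg_left ?_ (by norm_num))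
        · rw [integral_prod _ ho]
          refine (integral_mono ho.integral_prod_left (integrable_const _)
            fun V => integral_overlap_le A V).trans_eq ?_
          simp
        · refine (integral_mono_ae (integrable_finsetSum _ fun J _ => hq J)
            (integrable_const (T * √(2 ^ n))) ?_).trans_eq (by simp)
          filter_upwards [Measure.quasiMeasurePreserving_snd.ae ae_norm_eq_one_haarState] with p hp
          exact sum_queryWeight_le A _ hp

end QueryAlgorithm

/-- Here a stands for 2^(-n/4). For a ≤ 1/2 one has 4Ta² ≤ 2Ta; for a > 1/2 and T ≥ 1 the right side
is at least 3a > 1 and F ≤ 1 suffices; for T = 0 only a⁴ ≤ a is needed. -/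
lemma le_cloning_bound {F a : ℝ} {k T : ℕ} (ha0 : 0 < a) (ha1 : a ≤ 1) (hF : F ≤ 1)
    (h : F ≤ (k + 1) * a ^ 4 + 4 * T * a ^ 2) : F ≤ a * (2 * T + k + 1) := by
  have hk : (0 : ℝ) ≤ k := k.cast_nonneg
  have ha4 : a ^ 4 ≤ a := by
    simpa using pow_le_pow_of_le_one ha0.le ha1 (show 1 ≤ 4 by norm_num)
  have h1 : (k + 1) * a ^ 4 ≤ (k + 1) * a := by gcongr
  rcases Nat.eq_zero_or_pos T with rfl | hT
  · simp only [Nat.cast_zero, mul_zero, zero_mul, add_zero, zero_add] at h ⊢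
    linarith
  · have hT1 : (1 : ℝ) ≤ T := by exact_mod_cast hT
    by_cases ha : a ≤ 1 / 2
    · have : 4 * T * a ^ 2 ≤ a * (2 * T) := by
        have : 0 ≤ T * a * (1 / 2 - a) := by
          have := sub_nonneg.2 ha
          positivity
        nlinarith
      linarith
    · push Not at ha
      nlinarith [mul_nonneg ha0.le hk, mul_le_mul_of_nonneg_left hT1 ha0.le]

end BlackBoxCloning

open MeasureTheory BlackBoxCloning in
theorem theorem3p1 (n : ℕ) :
    (∃ μ : Measure (QubitUnitary n), IsStatePreparationLaw μ) ∧
    ∀ μ : BitString n → Measure (QubitUnitary n), (∀ i, IsStatePreparationLaw (μ i)) →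
      ∀ (k m T : ℕ) (A : QueryAlgorithm n k m T),
        (∀ J, Integrable (fun V => A.cloningFidelity V J) (Measure.pi μ)) ∧
        (∑ J : BitString n, ∫ V, A.cloningFidelity V J ∂(Measure.pi μ)) / 2 ^ n ≤
          (2 : ℝ) ^ (-(n : ℝ) / 4) * (2 * T + k + 1) := by
  refine ⟨exists_isStatePreparationLaw n, fun μ hμ k m T A => ?_⟩
  have (i : BitString n) : IsProbabilityMeasure (μ i) := (hμ i).isProbabilityMeasure
  refine ⟨fun J => QueryAlgorithm.integrable_cloningFidelity A J, ?_⟩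
  set a : ℝ := (2 : ℝ) ^ (-(n : ℝ) / 4) with ha
  have ha0 : 0 < a := Real.rpow_pos_of_pos two_pos _
  have ha1 : a ≤ 1 := by
    refine Real.rpow_le_one_of_one_le_of_nonpos one_le_two ?_
    have : (0 : ℝ) ≤ n := n.cast_nonneg
    linarith
  have hN : (0 : ℝ) < 2 ^ n := by positivity
  have ha4 : a ^ 4 = (2 ^ n)⁻¹ := by
    rw [ha, ← Real.rpow_natCast, ← Real.rpow_mul two_pos.le, ← Real.rpow_natCast 2 n,
      ← Real.rpow_neg two_pos.le]
    congr 1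
    push_cast
    ring
  have ha2 : √(2 ^ n) / 2 ^ n = a ^ 2 := by
    have h1 : √((2 : ℝ) ^ n) = (a ^ 2)⁻¹ := by
      rw [Real.sqrt_eq_iff_mul_self_eq hN.le (by positivity), ← mul_inv, ← pow_add, ha4, inv_inv]
    rw [h1, div_eq_mul_inv, ← ha4]
    field_simp
  refine le_cloning_bound ha0 ha1 ?_ ?_
  · rw [div_le_one hN]
    calc _ ≤ ∑ J : BitString n, (1 : ℝ) := Finset.sum_le_sum fun J _ => by
          refine (integral_mono (QueryAlgorithm.integrable_cloningFidelity A J)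
            (integrable_const (1 : ℝ)) fun V => ?_).trans_eq (by simp)
          simp only [QueryAlgorithm.cloningFidelity_eq]
          exact QueryAlgorithm.overlap_le_one _ _ (QueryAlgorithm.norm_preparedState _)
      _ = _ := by simp
  -- Dividing by N gives (k + 1)/(N + k) + 4T a²; dropping k from the denominator leaves (k + 1) a⁴
  -- as first term.
  · refine (div_le_div_of_nonneg_right
      (QueryAlgorithm.sum_integral_cloningFidelity_le hμ A) hN.le).trans ?_
    rw [add_div, mul_div_cancel_left₀ _ hN.ne', ← mul_assoc, mul_div_assoc, ha2, ha4,
      ← div_eq_mul_inv]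
    gcongr
    linarith [(k.cast_nonneg : (0 : ℝ) ≤ k)]
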